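/- **Conventions.** Adjoin an element $\tfrac10$ to $\mathbb Q$, with $k+\tfrac10=\tfrac10$ for $k\in\mathbb Z$, $1/\tfrac10=0$ and $1/0=\tfrac10$; $x^{-1}$ means $1/x$. For integers $a_0,\dots,a_l$ define $[a_0;a_1,\dots,a_l]\in\mathbb Q\cup\{\tfrac10\}$ by $[a_0]=a_0$ and $[a_0;a_1,\dots,a_l]=a_0+\dfrac1{[a_1;\dots,a_l]}$ for $l>0$. The Hopf link is the link in $S^3=\{(z,w)\in\mathbb C^2: |z|^2+|w|^2=1\}$ with the components $\{w=0\}$ and $\{z=0\}$. Surgery on it with coefficients $\frac pq$ and $\frac rs$ (each a pair of coprime integers, $\pm1/0$ being allowed) means: remove the interiors of disjoint tubular neighbourhoods of the two components, and glue two solid tori to the boundary by homeomorphisms of the boundary tori that carry their meridians onto the curves $p\mu_1+q\lambda_1$ and $r\mu_2+s\lambda_2$, respectively, where $\mu_i$ and $\lambda_i$ are the meridian and the preferred longitude of the $i$-th component. For coprime integers $a,b$, the lens space $L(a,b)$ is obtained by gluing two solid tori by a homeomorphism of their boundaries that carries the meridian of one onto the curve $a\lambda+b\mu$ on the boundary of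 the other, where $\mu,\lambda$ are its meridian and longitude. **Theorem.** Let $n,m\ge 0$, let $a_0,\dots,a_n,b_0,\dots,b_m$ be integers, and let $\frac pq,\frac rs\in\mathbb Q\cup\{\frac10\}$, in lowest terms, be given by $$\frac pq=[a_0;a_1,\dots,a_n],\qquad \frac rs=[b_0;b_1,\dots,b_{m-1},b_m+1]$$ ($\frac rs=[b_0+1]$ if $m=0$). Let $a,b$ be coprime integers with $$\frac ab=[-b_m;-b_{m-1},\dots,-b_0,a_0,\dots,a_n]^{(-1)^{m+1}}-1 .$$ Then surgery on the Hopf link with coefficients $\frac pq$ and $\frac rs$ is homeomorphic to the lens space $L(a,b)$, for every choice of the gluing homeomorphisms in the two constructions. If $\frac ab=\frac10$, it is homeomorphic to $S^3$, and if $\frac ab=\frac01$, it is homeomorphic to $S^2\times S^1$. -/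

import Mathlib

noncomputable section

namespace HopfSurgery

/-! ### Continued fractions with values in `ℚ ∪ {1/0}` -/

/-- The element `p/q` of `ℚ ∪ {1/0}`, where `p/0` is the added element `1/0`. -/
def frac (p q : ℤ) : OnePoint ℚ :=
  if q = 0 then OnePoint.infty else (((p : ℚ) / (q : ℚ) : ℚ) : OnePoint ℚ)

/-- Addition of an integer on `ℚ ∪ {1/0}`, with `n + 1/0 = 1/0`. -/
def addInt (n : ℤ) : OnePoint ℚ → OnePoint ℚ
  | OnePoint.infty => OnePoint.infty
  | OnePoint.some x => (((n : ℚ) + x : ℚ) : OnePoint ℚ)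

/-- The reciprocal on `ℚ ∪ {1/0}`, which exchanges `0` and `1/0`. -/
def recip : OnePoint ℚ → OnePoint ℚ
  | OnePoint.infty => ((0 : ℚ) : OnePoint ℚ)
  | OnePoint.some x => if x = 0 then OnePoint.infty else ((x⁻¹ : ℚ) : OnePoint ℚ)

/-- The value `[a₀; a₁, …, aₗ]` of a continued fraction with integer entries. The value `1/0`
of the empty list is a convention that gives `[a₀] = a₀ + 1/(1/0) = a₀`. -/
def contFrac : List ℤ → OnePoint ℚ
  | [] => OnePoint.infty
  | a :: l => addInt a (recip (contFrac l))

/-! ### Solid tori and gluing maps -/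

/-- The torus `S¹ × S¹`. -/
abbrev Torus : Type := Circle × Circle

/-- The solid torus `S¹ × D²`. -/
abbrev SolidTorus : Type := Circle × Metric.closedBall (0 : ℂ) 1

/-- The inclusion of the boundary torus `S¹ × ∂D²` into the solid torus `S¹ × D²`. The longitude
is the curve `S¹ × {1}`, the meridian is the curve `{1} × ∂D²`. -/
def boundary (t : Torus) : SolidTorus :=
  (t.1, ⟨(t.2 : ℂ), mem_closedBall_zero_iff.2 (Circle.norm_coe t.2).le⟩)

/-- The open solid torus `S¹ × int D²`. -/
def openSolidTorus : Set SolidTorus := {x | ‖(x.2 : ℂ)‖ < 1}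

/-- The curve on the torus that runs `l` times along the longitude and `m` times along the
meridian. -/
def torusCurve (l m : ℤ) : Set Torus := Set.range fun ζ : Circle => (ζ ^ l, ζ ^ m)

/-- A homeomorphism from the boundary torus of a solid torus to a torus, which carries the
meridian `{1} × ∂D²` onto the curve of class `l · longitude + m · meridian`. -/
structure Gluing (l m : ℤ) where
  toHomeo : Torus ≃ₜ Torus
  map_meridian : toHomeo '' {t | t.1 = 1} = torusCurve l m

/-- Gluing maps exist for every pair of coprime integers. -/
theorem Gluing.nonempty {l m : ℤ} (h : IsCoprime l m) : Nonempty (Gluing l m) := by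
  obtain ⟨x, y, hxy⟩ := h
  have key : ∀ u : Circle, u ^ (y * m) * u ^ (x * l) = u := by
    intro u
    rw [← zpow_add, show y * m + x * l = 1 by linarith, zpow_one]
  refine ⟨⟨⟨⟨fun t => (t.1 ^ y * t.2 ^ l, (t.1 ^ x)⁻¹ * t.2 ^ m),
    fun t => (t.1 ^ m * (t.2 ^ l)⁻¹, t.1 ^ x * t.2 ^ y), ?_, ?_⟩, ?_, ?_⟩, ?_⟩⟩
  · rintro ⟨u, v⟩
    refine Prod.ext ?_ ?_
    · simp only [mul_zpow, inv_zpow, ← zpow_mul, mul_inv, inv_inv]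
      rw [mul_mul_mul_comm, mul_comm m l, mul_inv_cancel, mul_one, key]
    · simp only [mul_zpow, inv_zpow, ← zpow_mul]
      rw [mul_mul_mul_comm, mul_comm x y, mul_inv_cancel, one_mul, mul_comm l x, mul_comm m y,
        mul_comm, key]
  · rintro ⟨u, v⟩
    refine Prod.ext ?_ ?_
    · simp only [mul_zpow, inv_zpow, ← zpow_mul]
      rw [mul_mul_mul_comm, mul_comm l y, inv_mul_cancel, mul_one, mul_comm m y, key]
    · simp only [mul_zpow, inv_zpow, ← zpow_mul, mul_inv, inv_inv]
      rw [mul_mul_mul_comm, mul_comm m x, inv_mul_cancel, one_mul, mul_comm l x, mul_comm, key]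
  · fun_prop
  · fun_prop
  · ext t
    constructor
    · rintro ⟨⟨u, v⟩, hu, rfl⟩
      obtain rfl : u = 1 := hu
      exact ⟨v, by simp⟩
    · rintro ⟨ζ, rfl⟩
      exact ⟨(1, ζ), rfl, by simp⟩

/-! ### Lens spaces -/

/-- The identification of boundary points that defines a lens space. -/
inductive LensSpace.Rel (g : Torus ≃ₜ Torus) :
    SolidTorus ⊕ SolidTorus → SolidTorus ⊕ SolidTorus → Prop
  | glue (t : Torus) : LensSpace.Rel g (Sum.inl (boundary (g t))) (Sum.inr (boundary t))

/-- The lens space `L(a, b)`: two solid tori glued along their boundaries in such a way that the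
meridian of the second one becomes the curve `a · longitude + b · meridian` of the first one. -/
def LensSpace {a b : ℤ} (g : Gluing a b) : Type := Quot (LensSpace.Rel g.toHomeo)

instance {a b : ℤ} (g : Gluing a b) : TopologicalSpace (LensSpace g) :=
  inferInstanceAs (TopologicalSpace (Quot _))

/-! ### Dehn surgery along a link -/

/-- A link in `X` with components indexed by `ι`, given by disjoint parametrized closed tubular
neighbourhoods. The `i`-th component is the core `nbhd i (S¹ × {0})`. -/
structure FramedLink (ι X : Type*) [TopologicalSpace X] where
  nbhd : ι → SolidTorus → X
  isClosedEmbedding : ∀ i, Topology.IsClosedEmbedding (nbhd i)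
  disjoint : ∀ i j, i ≠ j → Disjoint (Set.range (nbhd i)) (Set.range (nbhd j))

namespace FramedLink

variable {ι X : Type*} [TopologicalSpace X]

/-- The exterior of a link: the complement of the open tubular neighbourhoods. -/
def Exterior (L : FramedLink ι X) : Type _ := {x : X // ∀ i, x ∉ L.nbhd i '' openSolidTorus}

instance (L : FramedLink ι X) : TopologicalSpace L.Exterior :=
  inferInstanceAs (TopologicalSpace (Subtype _))

/-- The boundary torus of the `i`-th tubular neighbourhood as a subset of the exterior. -/
def boundaryTorus (L : FramedLink ι X) (i : ι) (t : Torus) : L.Exterior :=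
  ⟨L.nbhd i (boundary t), by
    rintro j ⟨x, hx, hxt⟩
    by_cases hij : j = i
    · subst hij
      have h := (L.isClosedEmbedding j).injective hxt
      subst h
      exact (lt_irrefl (1 : ℝ)) ((Circle.norm_coe t.2).symm.trans_lt hx)
    · exact Set.disjoint_left.1 (L.disjoint j i hij) ⟨x, rfl⟩ ⟨boundary t, hxt.symm⟩⟩

/-- The identification of boundary points that defines a surgery. -/
inductive DehnSurgery.Rel (L : FramedLink ι X) (g : ι → Torus ≃ₜ Torus) :
    L.Exterior ⊕ (Σ _ : ι, SolidTorus) → L.Exterior ⊕ (Σ _ : ι, SolidTorus) → Prop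
  | glue (i : ι) (t : Torus) :
      DehnSurgery.Rel L g (Sum.inl (L.boundaryTorus i (g i t))) (Sum.inr ⟨i, boundary t⟩)

/-- The result of surgery on a link: one solid torus for every component is glued to the exterior
along the given homeomorphisms of the boundary tori. -/
def DehnSurgery (L : FramedLink ι X) (g : ι → Torus ≃ₜ Torus) : Type _ :=
  Quot (DehnSurgery.Rel L g)

instance (L : FramedLink ι X) (g : ι → Torus ≃ₜ Torus) : TopologicalSpace (L.DehnSurgery g) :=
  inferInstanceAs (TopologicalSpace (Quot _))

end FramedLink

/-! ### The Hopf link -/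

/-- The three-sphere, as the unit sphere of `ℂ²`. -/
abbrev Sphere3 : Type := Metric.sphere (0 : EuclideanSpace ℂ (Fin 2)) 1

/-- The two-sphere, as the unit sphere of `ℝ³`. -/
abbrev Sphere2 : Type := Metric.sphere (0 : EuclideanSpace ℝ (Fin 3)) 1

/-- For `i = 0`, the point `(√(1 - |ζ|²/4) u, ζ/2)` of the three-sphere; for `i = 1`, the same
point with its coordinates exchanged. -/
def hopfNbhd (i : Fin 2) (x : SolidTorus) : Sphere3 :=
  ⟨WithLp.toLp 2 fun j => if j = i then
      ((√(1 - ‖(x.2 : ℂ)‖ ^ 2 / 4) : ℝ) : ℂ) * (x.1 : ℂ) else (x.2 : ℂ) / 2, by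
    have h : ‖(x.2 : ℂ)‖ ≤ 1 := mem_closedBall_zero_iff.1 x.2.2
    have h' : 0 ≤ 1 - ‖(x.2 : ℂ)‖ ^ 2 / 4 := by nlinarith [norm_nonneg (x.2 : ℂ)]
    rw [mem_sphere_zero_iff_norm, EuclideanSpace.norm_eq, Real.sqrt_eq_one, Fin.sum_univ_two]
    have hu : ‖(x.1 : ℂ)‖ = 1 := Circle.norm_coe x.1
    fin_cases i <;> simp [Real.sq_sqrt h', div_pow, hu] <;> ring⟩

theorem norm_le_one (x : SolidTorus) : ‖(x.2 : ℂ)‖ ≤ 1 := mem_closedBall_zero_iff.1 x.2.2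

theorem hopfNbhd_self (i : Fin 2) (x : SolidTorus) :
    (hopfNbhd i x).1 i = ((√(1 - ‖(x.2 : ℂ)‖ ^ 2 / 4) : ℝ) : ℂ) * (x.1 : ℂ) := by
  simp [hopfNbhd]

theorem hopfNbhd_other {i j : Fin 2} (h : j ≠ i) (x : SolidTorus) :
    (hopfNbhd i x).1 j = (x.2 : ℂ) / 2 := by
  simp [hopfNbhd, h]

theorem hopfNbhd_continuous (i : Fin 2) : Continuous (hopfNbhd i) := by
  refine Continuous.subtype_mk ((PiLp.continuous_toLp 2 _).comp (continuous_pi fun j => ?_)) _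
  split_ifs <;> fun_prop

theorem hopfNbhd_injective (i : Fin 2) : Function.Injective (hopfNbhd i) := by
  rintro ⟨u, z⟩ ⟨v, w⟩ h
  obtain ⟨j, hj⟩ : ∃ j : Fin 2, j ≠ i := exists_ne i
  have h1 := congrArg (fun y : Sphere3 => y.1 j) h
  simp only [hopfNbhd_other hj] at h1
  have hzw : z = w := Subtype.ext ((div_left_inj' two_ne_zero).1 h1)
  subst hzw
  have h2 := congrArg (fun y : Sphere3 => y.1 i) h
  simp only [hopfNbhd_self] at h2
  have hz : ‖(z : ℂ)‖ ≤ 1 := norm_le_one (u, z)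
  have hpos : 0 < √(1 - ‖(z : ℂ)‖ ^ 2 / 4) :=
    Real.sqrt_pos.2 (by nlinarith [norm_nonneg (z : ℂ)])
  have h3 := mul_left_cancel₀ (Complex.ofReal_ne_zero.2 hpos.ne') h2
  rw [Circle.ext h3]

/-- The standard Hopf link in the three-sphere, whose components are the great circles
`{(z, 0)}` and `{(0, w)}`, with the disjoint tubular neighbourhoods `|w| ≤ 1/2` and `|z| ≤ 1/2`.
Both parametrizations are orientation preserving, so that the meridians link the components once
positively. The longitudes `u ↦ (√3/2 · u, 1/2)` and `u ↦ (1/2, √3/2 · u)` are the preferred ones: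
they are null-homologous in the complement of their component, as one coordinate is constant. -/
def hopfLink : FramedLink (Fin 2) Sphere3 where
  nbhd := hopfNbhd
  isClosedEmbedding i := (hopfNbhd_continuous i).isClosedEmbedding (hopfNbhd_injective i)
  disjoint := by
    intro i j hij
    rw [Set.disjoint_left]
    rintro _ ⟨x, rfl⟩ ⟨y, hy⟩
    have h1 := congrArg (fun y : Sphere3 => ‖y.1 i‖ ^ 2) hy
    simp only [hopfNbhd_self, hopfNbhd_other hij] at h1
    have hx := norm_le_one x
    have hy' := norm_le_one y
    have h' : 0 ≤ 1 - ‖(x.2 : ℂ)‖ ^ 2 / 4 := by nlinarith [norm_nonneg (x.2 : ℂ)]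
    have hu : ‖(x.1 : ℂ)‖ = 1 := Circle.norm_coe x.1
    simp [Real.sq_sqrt h', div_pow, hu] at h1
    nlinarith [norm_nonneg (x.2 : ℂ), norm_nonneg (y.2 : ℂ)]

/-- Surgery on the Hopf link with coefficients `p/q` and `r/s`: the meridians of the new solid tori
are glued to the curves `p · meridian + q · longitude` and `r · meridian + s · longitude` on the
boundary tori of the neighbourhoods of the two components. -/
abbrev HopfLinkSurgery {p q r s : ℤ} (g₁ : Gluing q p) (g₂ : Gluing s r) : Type :=
  hopfLink.DehnSurgery ![g₁.toHomeo, g₂.toHomeo]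

end HopfSurgery

end

open HopfSurgery

/-! The problem reduces to a pair of curves on one torus. The exterior of the Hopf link is a torus
times an interval, and crossing it exchanges longitude and meridian. Collapsing it turns the surgery
into two solid tori glued along one homeomorphism (`surgeryHomeomorph`). On the boundary torus of
the second neighbourhood the two new meridians are the curves of classes `(p, q)` and `(s, r)`,
written as (longitude, meridian).

A union of two solid tori does not change, up to homeomorphism, when the gluing map is composed with
torus homeomorphisms that preserve the meridian, since these extend over the solid torus
(`exists_extension`). The gluing maps are arbitrary, not linear, so the extension is made by hand:
cutting along the meridian gives a homeomorphism of an annulus, which is coned off over a cylinder.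
It remains to find a homeomorphism of the torus that carries `(p, q)` to `(c, d)` and `(s, r)` to
the meridian `(0, 1)`.

Let `M x` be the matrix `!![x, 1; 1, 0]` and `J` the swap. Up to sign, `(p, q)` is `M a₀ ⋯ M aₙ (1,
0)`, and `(r, s)` is the analogous product for the `bᵢ`. Since `M (-x) J (M x) = J`, the product `M
(-bₘ) ⋯ M (-b₀)` takes `(s, r)` to `±(1, 1)` (`contVec_reverse_neg`), and it takes `(p, q)` to a
vector of slope `[-bₘ; …, -b₀, a₀, …, aₙ]`. Finally `M (-1)` and `M (-1) (M 0)` both move `(1, 1)`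
to `(0, 1)`; on slopes they are `x ↦ 1/x - 1` and `x ↦ x - 1`. As `J` fixes `(1, 1)`, either
exponent would do for an unoriented homeomorphism; the stated parity makes the number of factors
even, so the determinant is `1`. Signs do not matter because curves are only sets. -/

noncomputable section

namespace HopfSurgery

/-! ### Cutting the torus along a meridian -/

/-- The parametrization of the circle by `[-1, 1]` with both end points mapped to `1`. -/
def cut (x : ℝ) : Circle := Circle.exp (Real.pi * (x + 1))

/-- The retraction of the real line onto `[-1, 1]`. -/
def clamp (x : ℝ) : ℝ := max (-1) (min 1 x)

theorem continuous_cut : Continuous cut := by unfold cut; fun_prop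

theorem continuous_clamp : Continuous clamp := by unfold clamp; fun_prop

theorem abs_clamp_le (x : ℝ) : |clamp x| ≤ 1 := by
  unfold clamp; rw [abs_le]; constructor <;> simp

theorem clamp_of_abs_le {x : ℝ} (h : |x| ≤ 1) : clamp x = x := by
  rw [abs_le] at h; simp [clamp, h.1, h.2]

theorem clamp_of_one_le {x : ℝ} (h : 1 ≤ x) : clamp x = 1 := by
  unfold clamp; rw [min_eq_left h]; norm_num

theorem clamp_of_le_neg_one {x : ℝ} (h : x ≤ -1) : clamp x = -1 := by
  unfold clamp; rw [min_eq_right (by linarith), max_eq_left h]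

theorem cut_one : cut 1 = 1 := by
  unfold cut
  rw [show Real.pi * (1 + 1) = 2 * Real.pi by ring, Circle.exp_two_pi]

theorem cut_neg_one : cut (-1) = 1 := by simp [cut]

theorem cut_injOn {x y : ℝ} (h : cut x = cut y) (hx : |x| < 1) (hy : |y| ≤ 1) : x = y := by
  obtain ⟨m, hm⟩ := Circle.exp_eq_exp.1 h
  have h1 : x - y = 2 * m := by
    have := Real.pi_pos.ne'
    apply mul_left_cancel₀ this
    linarith
  rw [abs_lt] at hx
  rw [abs_le] at hy
  have h2 : (m : ℝ) < 1 := by linarith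
  have h3 : (-1 : ℝ) < m := by linarith
  have h4 : m = 0 := by
    have : m < 1 := by exact_mod_cast h2
    have : -1 < m := by exact_mod_cast h3
    omega
  subst h4
  simp at h1
  linarith

theorem cut_eq_one {x : ℝ} (h : cut x = 1) (hx : |x| ≤ 1) : x = 1 ∨ x = -1 := by
  rcases hx.lt_or_eq with hx | hx
  · have h1 := cut_injOn (h.trans cut_one.symm) hx (by simp)
    rw [h1] at hx
    simp at hx
  · exact eq_or_eq_neg_of_abs_eq hx

theorem cut_surjective (u : Circle) : ∃ x, |x| ≤ 1 ∧ cut x = u := by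
  -- The shift by `π` in the definition gives `cut x = -exp (iπx)`, hence the argument of `-u`.
  refine ⟨Complex.arg (-u : ℂ) / Real.pi, ?_, ?_⟩
  · rw [abs_div, abs_of_pos Real.pi_pos, div_le_one Real.pi_pos]
    exact Complex.abs_arg_le_pi _
  · unfold cut
    rw [mul_add, mul_div_cancel₀ _ Real.pi_pos.ne', Circle.exp_add]
    ext
    have : ‖(-u : ℂ)‖ = 1 := by rw [norm_neg]; exact Circle.norm_coe u
    have h2 := Complex.norm_mul_exp_arg_mul_I (-u : ℂ)
    rw [this] at h2
    simp only [Circle.coe_mul, Circle.coe_exp, mul_one, Complex.exp_pi_mul_I]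
    simp only [Complex.ofReal_one, one_mul] at h2
    rw [h2]; simp

/-- A lift of a homeomorphism of the torus that preserves the meridian to the annulus that is
obtained by cutting along the meridian, given by its coordinate along the longitude. -/
structure IsAnnulusLift (h : Torus ≃ₜ Torus) (T : ℝ × Circle → ℝ) : Prop where
  continuous : Continuous T
  abs_apply_le : ∀ x v, |T (x, v)| ≤ 1
  apply_clamp : ∀ x v, T (clamp x, v) = T (x, v)
  cut_apply : ∀ x v, cut (T (x, v)) = (h (cut (clamp x), v)).1

/-- The first coordinate of `h` is a homotopy of maps of the circle that starts at the constant `1`,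
so it lifts through the covering `Circle.exp`. Divided by `2π`, the lift is never an integer on the
open annulus, because only the meridian goes to the meridian. By connectedness its values stay in
one interval `[k, k + 1]`, which is rescaled to `[-1, 1]`. Each end of the annulus is connected and
goes to the discrete set `{1, -1}`, so `T` is constant there. -/
theorem exists_isAnnulusLift (h : Torus ≃ₜ Torus) (hM : ∀ t, (h t).1 = 1 ↔ t.1 = 1) :
    ∃ T, IsAnnulusLift h T ∧ ∃ y₁ y₂ : ℝ, (y₁ = 1 ∨ y₁ = -1) ∧ (y₂ = 1 ∨ y₂ = -1) ∧
      (∀ v, T (1, v) = y₁) ∧ ∀ v, T (-1, v) = y₂ := by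
  let H : C(unitInterval × Circle, Circle) :=
    ⟨fun x => (h (cut (2 * (x.1 : ℝ) - 1), x.2)).1, by
      have := continuous_cut
      fun_prop⟩
  have H_0 : ∀ v, H (0, v) = Circle.exp ((ContinuousMap.const Circle (0 : ℝ)) v) := by
    intro v
    simp only [H, ContinuousMap.coe_mk, ContinuousMap.const_apply, Circle.exp_zero]
    rw [hM]
    simp [cut_neg_one]
  let L := Circle.isCoveringMap_exp.liftHomotopy H _ H_0
  have hL : ∀ s v, Circle.exp (L (s, v)) = (h (cut (2 * (s : ℝ) - 1), v)).1 := fun s v =>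
    congrFun (Circle.isCoveringMap_exp.liftHomotopy_lifts H _ H_0) (s, v)
  let half : ℝ → unitInterval := fun x => ⟨(clamp x + 1) / 2, by
    have := abs_le.1 (abs_clamp_le x)
    constructor <;> linarith⟩
  have half_cont : Continuous half := by
    have := continuous_clamp
    exact Continuous.subtype_mk (by fun_prop) _
  let N : ℝ × Circle → ℝ := fun x => L (half x.1, x.2) / (2 * Real.pi)
  have N_cont : Continuous N := by fun_prop
  have hN : ∀ x v, Circle.exp (2 * Real.pi * N (x, v)) = (h (cut (clamp x), v)).1 := by
    intro x v
    have := Real.pi_pos.ne'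
    simp only [N]
    rw [mul_div_cancel₀ _ (by positivity), hL]
    simp only [half]
    congr 5
    ring
  let D : Set (ℝ × Circle) := Set.Ioo (-1) 1 ×ˢ Set.univ
  have hD : IsPreconnected D := isPreconnected_Ioo.prod isPreconnected_univ
  have hexp : ∀ k : ℤ, Circle.exp (2 * Real.pi * k) = 1 := by
    intro k
    rw [Circle.exp_eq_one]
    exact ⟨k, by ring⟩
  have not_int : ∀ x ∈ D, ∀ k : ℤ, N x ≠ k := by
    rintro ⟨x, v⟩ hx k hk
    have hx' : |x| < 1 := abs_lt.2 hx.1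
    have h1 := hN x v
    rw [hk, hexp, clamp_of_abs_le hx'.le] at h1
    rcases cut_eq_one ((hM _).1 h1.symm) hx'.le with h2 | h2 <;> rw [h2] at hx' <;> simp at hx'
  have hD0 : ((0, 1) : ℝ × Circle) ∈ D := by simp [D]
  have hord := (hD.image N N_cont.continuousOn).ordConnected
  let k : ℤ := ⌊N (0, 1)⌋
  have hk1 : (k : ℝ) ≤ N (0, 1) := Int.floor_le _
  have hk2 : N (0, 1) < k + 1 := Int.lt_floor_add_one _
  have hbound : ∀ x ∈ D, N x ∈ Set.Icc (k : ℝ) (k + 1) := by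
    intro x hx
    constructor
    · by_contra! hlt
      obtain ⟨y, hy, hy'⟩ := hord.out ⟨x, hx, rfl⟩ ⟨_, hD0, rfl⟩ ⟨hlt.le, hk1⟩
      exact not_int y hy k hy'
    · by_contra! hlt
      obtain ⟨y, hy, hy'⟩ := hord.out ⟨_, hD0, rfl⟩ ⟨x, hx, rfl⟩ ⟨hk2.le, hlt.le⟩
      exact not_int y hy (k + 1) (by push_cast; exact hy')
  have hclos : ∀ x v, |x| ≤ 1 → ((x, v) : ℝ × Circle) ∈ closure D := by
    intro x v hx
    rw [closure_prod_eq, closure_Ioo (by norm_num)]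
    exact ⟨abs_le.1 hx, by simp⟩
  have hNclamp : ∀ x v, N (clamp x, v) = N (x, v) := by
    intro x v
    simp only [N, half, clamp_of_abs_le (abs_clamp_le x)]
  have hbound' : ∀ x v, N (x, v) ∈ Set.Icc (k : ℝ) (k + 1) := by
    intro x v
    rw [← hNclamp]
    exact closure_minimal hbound (isClosed_Icc.preimage N_cont)
      (hclos _ v (abs_clamp_le x))
  let T : ℝ × Circle → ℝ := fun x => 2 * (N x - k) - 1
  have T_cont : Continuous T := by fun_prop
  have T_abs : ∀ x v, |T (x, v)| ≤ 1 := by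
    intro x v
    have := hbound' x v
    rw [abs_le]
    simp only [T]
    constructor <;> linarith [this.1, this.2]
  have T_cut : ∀ x v, cut (T (x, v)) = (h (cut (clamp x), v)).1 := by
    intro x v
    rw [← hN]
    simp only [T, cut]
    rw [show Real.pi * (2 * (N (x, v) - k) - 1 + 1) = 2 * Real.pi * N (x, v) - 2 * Real.pi * k by
      ring, Circle.exp_sub, hexp, div_one]
  have T_end : ∀ x, cut (clamp x) = 1 → ∃ y : ℝ, (y = 1 ∨ y = -1) ∧ ∀ v, T (x, v) = y := by
    intro x hx
    have hmaps : Set.MapsTo (fun v => T (x, v)) Set.univ ({1, -1} : Set ℝ) := by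
      intro v _
      refine cut_eq_one ?_ (T_abs x v)
      rw [T_cut, hM]
      exact hx
    obtain ⟨y, hy, hy'⟩ := isPreconnected_univ.eqOn_const_of_mapsTo (Set.toFinite _).isDiscrete
      (T := ({1, -1} : Set ℝ)) (f := fun v : Circle => T (x, v))
      (by fun_prop) hmaps ⟨1, by simp⟩
    exact ⟨y, hy, fun v => hy' (Set.mem_univ v)⟩
  obtain ⟨y₁, hy₁, hy₁'⟩ := T_end 1 (by rw [clamp_of_one_le le_rfl, cut_one])
  obtain ⟨y₂, hy₂, hy₂'⟩ := T_end (-1) (by rw [clamp_of_le_neg_one le_rfl, cut_neg_one])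
  exact ⟨T, ⟨T_cont, T_abs, fun x v => by simp only [T, hNclamp], T_cut⟩, y₁, y₂, hy₁, hy₂, hy₁',
    hy₂'⟩

/-- After applying `cut` both sides agree, which determines the value on the open annulus, where
`cut` is injective. The ends, which `cut` does not distinguish, follow by continuity. -/
theorem IsAnnulusLift.apply_apply {h : Torus ≃ₜ Torus} {T T' : ℝ × Circle → ℝ}
    (hT : IsAnnulusLift h T) (hT' : IsAnnulusLift h.symm T') (x : ℝ) (v : Circle) :
    T' (T (x, v), (h (cut (clamp x), v)).2) = clamp x := by
  have cut_cont := continuous_cut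
  have clamp_cont := continuous_clamp
  have T_cont := hT.continuous
  have T'_cont := hT'.continuous
  have h1 : Set.EqOn (fun x : ℝ × Circle => T' (T x, (h (cut (clamp x.1), x.2)).2))
      (fun x => clamp x.1) (Set.Ioo (-1) 1 ×ˢ Set.univ) := by
    rintro ⟨x, v⟩ ⟨hx, -⟩
    have hx' : |x| < 1 := abs_lt.2 hx
    simp only
    rw [clamp_of_abs_le hx'.le]
    refine (cut_injOn ?_ hx' (hT'.abs_apply_le _ _)).symm
    rw [hT'.cut_apply, clamp_of_abs_le (hT.abs_apply_le x v), hT.cut_apply, clamp_of_abs_le hx'.le,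
      Prod.mk.eta, h.symm_apply_apply]
  have h2 := h1.closure (by fun_prop) (by fun_prop)
  have h3 := @h2 (clamp x, v) (by
    rw [closure_prod_eq, closure_Ioo (by norm_num)]
    exact ⟨abs_le.1 (abs_clamp_le x), by simp⟩)
  simp only [clamp_of_abs_le (abs_clamp_le x), hT.apply_clamp] at h3
  exact h3

/-- A homeomorphism of the torus and its inverse have lifts to the annulus which both preserve or
both exchange the ends of the annulus. -/
theorem exists_isAnnulusLift_symm (h : Torus ≃ₜ Torus) (hM : ∀ t, (h t).1 = 1 ↔ t.1 = 1) :
    ∃ (T T' : ℝ × Circle → ℝ) (ε : ℝ), ε * ε = 1 ∧ IsAnnulusLift h T ∧ IsAnnulusLift h.symm T' ∧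
      (∀ v, T (1, v) = ε) ∧ (∀ v, T (-1, v) = -ε) ∧
      (∀ v, T' (1, v) = ε) ∧ (∀ v, T' (-1, v) = -ε) := by
  have hM' : ∀ t, (h.symm t).1 = 1 ↔ t.1 = 1 := by
    intro t
    rw [← hM, h.apply_symm_apply]
  obtain ⟨T, hT, y₁, y₂, hy₁, hy₂, hT₁, hT₂⟩ := exists_isAnnulusLift h hM
  obtain ⟨T', hT', z₁, z₂, hz₁, hz₂, hT'₁, hT'₂⟩ := exists_isAnnulusLift h.symm hM'
  have e1 := hT.apply_apply hT' 1 1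
  have e2 := hT.apply_apply hT' (-1) 1
  rw [clamp_of_one_le le_rfl, hT₁] at e1
  rw [clamp_of_le_neg_one le_rfl, hT₂] at e2
  -- `e1` and `e2` say that `T'` sends the end `y₁` to `1` and the end `y₂` to `-1`. Hence `y₁ ≠
  -- y₂`, and `T'` keeps or exchanges the ends as `T` does.
  have key : y₁ * y₁ = 1 ∧ y₂ = -y₁ ∧ z₁ = y₁ ∧ z₂ = -y₁ := by
    rcases hy₁ with rfl | rfl <;> rcases hy₂ with rfl | rfl <;>
      simp only [hT'₁, hT'₂] at e1 e2 <;> rw [e1] at * <;> rw [e2] at * <;> norm_num at *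
  obtain ⟨k1, rfl, rfl, rfl⟩ := key
  exact ⟨T, T', z₁, k1, hT, hT', hT₁, hT₂, hT'₁, hT'₂⟩

theorem IsAnnulusLift.of_one_le {h : Torus ≃ₜ Torus} {T : ℝ × Circle → ℝ} (hT : IsAnnulusLift h T)
    {x : ℝ} (hx : 1 ≤ x) (v : Circle) : T (x, v) = T (1, v) := by
  rw [← hT.apply_clamp, clamp_of_one_le hx]

theorem IsAnnulusLift.of_le_neg_one {h : Torus ≃ₜ Torus} {T : ℝ × Circle → ℝ}
    (hT : IsAnnulusLift h T) {x : ℝ} (hx : x ≤ -1) (v : Circle) : T (x, v) = T (-1, v) := by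
  rw [← hT.apply_clamp, clamp_of_le_neg_one hx]

/-! ### Coning off a homeomorphism of the annulus -/

/-- The direction of a complex number, as a point of the circle. -/
def direction (z : ℂ) : Circle := Circle.exp z.arg

theorem norm_mul_direction (z : ℂ) : (‖z‖ : ℂ) * direction z = z := by
  simp [direction, Complex.norm_mul_exp_arg_mul_I]

theorem direction_mul {r : ℝ} (hr : 0 < r) (v : Circle) : direction ((r : ℂ) * v) = v := by
  ext
  apply mul_left_cancel₀ (Complex.ofReal_ne_zero.2 hr.ne')
  have := norm_mul_direction ((r : ℂ) * v)
  rwa [norm_mul, Circle.norm_coe, mul_one, Complex.norm_real, Real.norm_of_nonneg hr.le] at this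

/-- The jump of `arg` on the negative real axis disappears after `Circle.exp`: away from `0` the
direction is `w / ‖w‖`. -/
theorem continuousAt_direction {z : ℂ} (hz : z ≠ 0) : ContinuousAt direction z := by
  have ind : Topology.IsInducing (fun u : Circle => (u : ℂ)) := ⟨rfl⟩
  refine ind.continuousAt_iff.2 ?_
  have : ((fun u : Circle => (u : ℂ)) ∘ direction) =ᶠ[nhds z] fun w => w / (‖w‖ : ℂ) := by
    filter_upwards [isOpen_ne.mem_nhds hz] with w hw
    have h1 : (‖w‖ : ℂ) ≠ 0 := by simpa using hw
    rw [eq_div_iff h1, mul_comm]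
    exact norm_mul_direction w
  refine ContinuousAt.congr ?_ this.symm
  have h1 : (‖z‖ : ℂ) ≠ 0 := by simpa using hz
  fun_prop (disch := assumption)

/-- The homogeneous extension of a bounded function on the annulus is continuous. -/
theorem continuous_homogeneous {E : Type*} [NormedAddCommGroup E] [NormedSpace ℝ E]
    {k : ℝ × Circle → E} (hk : Continuous k) (hb : ∀ x v, ‖k (x, v)‖ ≤ 1) :
    Continuous fun y : ℂ × ℝ => ‖y.1‖ • k (y.2 / ‖y.1‖, direction y.1) := by
  rw [continuous_iff_continuousAt]
  rintro ⟨z, t⟩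
  by_cases hz : z = 0
  · subst hz
    rw [ContinuousAt]
    simp only [norm_zero, zero_smul]
    -- Near `z = 0` the argument `t / ‖z‖` of `k` need not converge; boundedness of `k` and the
    -- factor `‖z‖` suffice.
    refine squeeze_zero_norm (a := fun y : ℂ × ℝ => ‖y.1‖) ?_ ?_
    · rintro ⟨w, s⟩
      rw [norm_smul, norm_norm]
      exact mul_le_of_le_one_right (norm_nonneg _) (hb _ _)
    · have : Continuous fun y : ℂ × ℝ => ‖y.1‖ := by fun_prop
      simpa using this.tendsto ((0 : ℂ), t)
  · have h1 : ‖z‖ ≠ 0 := by simpa using hz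
    have h2 : ContinuousAt (fun y : ℂ × ℝ => direction y.1) (z, t) :=
      ContinuousAt.comp (f := Prod.fst) (x := (z, t)) (continuousAt_direction hz) continuousAt_fst
    have h3 : ContinuousAt (fun y : ℂ × ℝ => y.2 / ‖y.1‖) (z, t) := by
      fun_prop (disch := assumption)
    have h4 : ContinuousAt (fun y : ℂ × ℝ => k (y.2 / ‖y.1‖, direction y.1)) (z, t) :=
      ContinuousAt.comp (f := fun y : ℂ × ℝ => (y.2 / ‖y.1‖, direction y.1)) (x := (z, t))
        hk.continuousAt (h3.prodMk h2)
    exact (by fun_prop : ContinuousAt (fun y : ℂ × ℝ => ‖y.1‖) (z, t)).smul h4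

/-- The cone over a map of the sphere that bounds the cylinder `|z| ≤ 1`, `|t| ≤ 1`. The map is
given by `k` and `T` on the lateral surface, and by coning on the bases. -/
def coneMap (T : ℝ × Circle → ℝ) (k : ℝ × Circle → Circle) (ε : ℝ) (y : ℂ × ℝ) : ℂ × ℝ :=
  (‖y.1‖ • (k (y.2 / ‖y.1‖, direction y.1) : ℂ),
    if ‖y.1‖ ≤ |y.2| then ε * y.2 else ‖y.1‖ • T (y.2 / ‖y.1‖, direction y.1))

section Cone

variable {T T' : ℝ × Circle → ℝ} {k k' : ℝ × Circle → Circle} {ε : ℝ}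

/-- The two formulas for the height agree where `‖z‖ = |t|`, because `T` is `±ε` at the ends. This
makes the pieces of the cone fit together continuously. -/
theorem coneMap_snd_of_le (h₁ : ∀ x v, 1 ≤ x → T (x, v) = ε)
    (h₂ : ∀ x v, x ≤ -1 → T (x, v) = -ε) {y : ℂ × ℝ} (hy : |y.2| ≤ ‖y.1‖) :
    (coneMap T k ε y).2 = ‖y.1‖ * T (y.2 / ‖y.1‖, direction y.1) := by
  unfold coneMap
  simp only [smul_eq_mul]
  split_ifs with h
  · have h3 := le_antisymm h hy
    by_cases hz : ‖y.1‖ = 0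
    · rw [hz] at h3
      rw [hz, abs_eq_zero.1 h3.symm]
      simp
    · rcases abs_choice y.2 with h4 | h4
      · have h5 : y.2 = ‖y.1‖ := by rw [h3, h4]
        rw [h5, div_self hz, h₁ _ _ le_rfl, mul_comm]
      · have h5 : y.2 = -‖y.1‖ := by rw [h3, h4, neg_neg]
        rw [h5, neg_div, div_self hz, h₂ _ _ le_rfl]
        ring
  · rfl

theorem norm_coneMap_fst (y : ℂ × ℝ) : ‖(coneMap T k ε y).1‖ = ‖y.1‖ := by
  rw [coneMap, norm_smul, norm_norm, Circle.norm_coe, mul_one]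

theorem continuous_coneMap (hT : Continuous T) (hk : Continuous k) (hb : ∀ x v, |T (x, v)| ≤ 1)
    (h₁ : ∀ x v, 1 ≤ x → T (x, v) = ε) (h₂ : ∀ x v, x ≤ -1 → T (x, v) = -ε) :
    Continuous (coneMap T k ε) := by
  have c1 := continuous_homogeneous (k := fun x => (k x : ℂ)) (by fun_prop)
    (fun x v => (Circle.norm_coe _).le)
  have c2 := continuous_homogeneous hT hb
  refine c1.prodMk (Continuous.if_le (by fun_prop) c2 (by fun_prop) (by fun_prop) ?_)
  intro y hy
  have := coneMap_snd_of_le (k := k) h₁ h₂ hy.symm.le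
  rw [coneMap] at this
  simpa [hy.le] using this

theorem abs_coneMap_snd_le (hε : ε * ε = 1) (hb : ∀ x v, |T (x, v)| ≤ 1) {y : ℂ × ℝ}
    (hy : ‖y.1‖ ≤ 1) (hy' : |y.2| ≤ 1) : |(coneMap T k ε y).2| ≤ 1 := by
  have hε' : |ε| = 1 := by
    rw [← abs_one (α := ℝ)]
    rcases mul_self_eq_one_iff.1 hε with h | h <;> simp [h]
  unfold coneMap
  simp only [smul_eq_mul]
  split_ifs with h
  · rwa [abs_mul, hε', one_mul]
  · rw [abs_mul, abs_norm]
    exact mul_le_one₀ hy (abs_nonneg _) (hb _ _)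

/-- Both cone maps preserve `‖z‖` and each of the regions `|t| ≤ ‖z‖` and `‖z‖ ≤ |t|`. On the first,
the claim is that the annulus maps are inverse to each other, extended homogeneously. On the second,
heights are multiplied by `ε` twice, and only the circle maps at the ends enter. -/
theorem coneMap_coneMap (hε : ε * ε = 1) (hb : ∀ x v, |T (x, v)| ≤ 1)
    (h₁ : ∀ x v, 1 ≤ x → T (x, v) = ε) (h₂ : ∀ x v, x ≤ -1 → T (x, v) = -ε)
    (h₁' : ∀ x v, 1 ≤ x → T' (x, v) = ε) (h₂' : ∀ x v, x ≤ -1 → T' (x, v) = -ε)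
    {κ' : Circle → Circle} (hκ' : ∀ x v, 1 ≤ |x| → k' (x, v) = κ' v)
    (hT : ∀ x v, T' (T (x, v), k (x, v)) = clamp x)
    (hk : ∀ x v, k' (T (x, v), k (x, v)) = v) (y : ℂ × ℝ) :
    coneMap T' k' ε (coneMap T k ε y) = y := by
  obtain ⟨z, t⟩ := y
  by_cases hz : z = 0
  · subst hz
    have : ε * (ε * t) = t := by rw [← mul_assoc, hε, one_mul]
    simp only [coneMap, norm_zero, abs_nonneg, zero_smul, if_true, this]
  have hr : 0 < ‖z‖ := by simpa using hz
  have hε' : |ε| = 1 := by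
    rcases mul_self_eq_one_iff.1 hε with h | h <;> simp [h]
  have e1 : (coneMap T k ε (z, t)).1 = (‖z‖ : ℂ) * k (t / ‖z‖, direction z) := by
    simp [coneMap]
  have n1 : ‖(coneMap T k ε (z, t)).1‖ = ‖z‖ := norm_coneMap_fst _
  have d1 : direction (coneMap T k ε (z, t)).1 = k (t / ‖z‖, direction z) := by
    rw [e1, direction_mul hr]
  have hdir : k' ((coneMap T k ε (z, t)).2 / ‖z‖, k (t / ‖z‖, direction z)) = direction z := by
    by_cases ht : ‖z‖ ≤ |t|
    · have e2 : (coneMap T k ε (z, t)).2 = ε * t := by simp [coneMap, ht]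
      -- In this region `T` has absolute value `1`, so both heights lie where `k'` equals `κ'` and
      -- may be exchanged; then `hk` applies.
      rw [e2, hκ', ← hκ' (T (t / ‖z‖, direction z)), hk]
      · have h3 : 1 ≤ |t / ‖z‖| := by rwa [abs_div, abs_norm, one_le_div hr]
        rcases le_abs.1 h3 with h | h
        · rw [h₁ _ _ h, hε']
        · rw [h₂ _ _ (by linarith), abs_neg, hε']
      · rwa [abs_div, abs_norm, one_le_div hr, abs_mul, hε', one_mul]
    · rw [coneMap_snd_of_le h₁ h₂ (not_le.1 ht).le]
      simp only
      rw [mul_div_cancel_left₀ _ hr.ne', hk]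
  refine Prod.ext ?_ ?_
  · simp only [coneMap] at hdir n1 d1 ⊢
    rw [n1, d1, hdir]
    simpa using norm_mul_direction z
  · by_cases ht : ‖z‖ ≤ |t|
    · have e2 : (coneMap T k ε (z, t)).2 = ε * t := by simp [coneMap, ht]
      have h5 : ‖(coneMap T k ε (z, t)).1‖ ≤ |(coneMap T k ε (z, t)).2| := by
        rw [n1, e2, abs_mul, hε', one_mul]; exact ht
      rw [coneMap, if_pos h5, e2, ← mul_assoc, hε, one_mul]
    · have e2 := coneMap_snd_of_le (k := k) h₁ h₂ (y := (z, t)) (not_le.1 ht).le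
      have h5 : |(coneMap T k ε (z, t)).2| ≤ ‖(coneMap T k ε (z, t)).1‖ := by
        rw [n1, e2, abs_mul, abs_norm]
        exact mul_le_of_le_one_right hr.le (hb _ _)
      rw [coneMap_snd_of_le h₁' h₂' h5, n1, d1, e2]
      simp only
      rw [mul_div_cancel_left₀ _ hr.ne', hT, clamp_of_abs_le, mul_div_cancel₀ _ hr.ne']
      rw [abs_div, abs_norm, div_le_one hr]
      exact (not_le.1 ht).le

end Cone

/-! ### Extending homeomorphisms of the torus over the solid torus -/

/-- A homeomorphism that is compatible with the fibres of a quotient map descends. -/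
theorem exists_homeomorph_of_isQuotientMap {X X' Y Y' : Type*} [TopologicalSpace X]
    [TopologicalSpace X'] [TopologicalSpace Y] [TopologicalSpace Y'] {f : X → Y} {f' : X' → Y'}
    (hf : Topology.IsQuotientMap f) (hf' : Topology.IsQuotientMap f') (F : X ≃ₜ X')
    (h : ∀ x y, f x = f y ↔ f' (F x) = f' (F y)) :
    ∃ G : Y ≃ₜ Y', ∀ x, G (f x) = f' (F x) := by
  have q : Topology.IsQuotientMap (f' ∘ F) := hf'.comp F.isQuotientMap
  have h₁ : Function.FactorsThrough (f' ∘ F) f := fun x y hxy => (h x y).1 hxy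
  have h₂ : Function.FactorsThrough f (f' ∘ F) := fun x y hxy => (h x y).2 hxy
  let p : C(X, Y) := ⟨f, hf.continuous⟩
  let p' : C(X, Y') := ⟨f' ∘ F, q.continuous⟩
  let G := Topology.IsQuotientMap.lift (f := p) hf p' h₁
  let G' := Topology.IsQuotientMap.lift (f := p') q p h₂
  have hG : ∀ x, G (f x) = f' (F x) := fun x =>
    DFunLike.congr_fun (Topology.IsQuotientMap.lift_comp (f := p) hf p' h₁) x
  have hG' : ∀ x, G' (f' (F x)) = f x := fun x =>
    DFunLike.congr_fun (Topology.IsQuotientMap.lift_comp (f := p') q p h₂) x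
  refine ⟨⟨⟨G, G', fun y => ?_, fun y => ?_⟩, G.continuous, G'.continuous⟩, hG⟩
  · obtain ⟨x, rfl⟩ := hf.surjective y
    rw [hG, hG']
  · obtain ⟨x, rfl⟩ := q.surjective y
    simp only [Function.comp_apply]
    rw [hG', hG]

/-- The cylinder that is obtained by cutting a solid torus along a meridian disc. -/
abbrev Cylinder : Type := Metric.closedBall (0 : ℂ) 1 × Set.Icc (-1 : ℝ) 1

/-- The quotient map which glues the two bases of the cylinder. -/
def Cylinder.toSolidTorus (y : Cylinder) : SolidTorus := (cut y.2, y.1)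

theorem Cylinder.isQuotientMap_toSolidTorus : Topology.IsQuotientMap toSolidTorus := by
  have c : Continuous toSolidTorus := by
    have := continuous_cut
    unfold toSolidTorus
    fun_prop
  refine c.isClosedMap.isQuotientMap c ?_
  rintro ⟨u, z⟩
  obtain ⟨x, hx, rfl⟩ := cut_surjective u
  exact ⟨(z, ⟨x, abs_le.1 hx⟩), rfl⟩

/-- The cone construction as a self-map of the cylinder. -/
theorem exists_cylinder_map {h : Torus ≃ₜ Torus} {T : ℝ × Circle → ℝ} {ε : ℝ} (hε : ε * ε = 1)
    (hT : IsAnnulusLift h T) (hT₁ : ∀ v, T (1, v) = ε) (hT₂ : ∀ v, T (-1, v) = -ε) :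
    ∃ F : Cylinder → Cylinder, Continuous F ∧
      ∀ y, (((F y).1 : ℂ), ((F y).2 : ℝ)) =
        coneMap T (fun x => (h (cut (clamp x.1), x.2)).2) ε ((y.1 : ℂ), (y.2 : ℝ)) := by
  have cut_cont := continuous_cut
  have clamp_cont := continuous_clamp
  have c := continuous_coneMap (ε := ε) (k := fun x => (h (cut (clamp x.1), x.2)).2)
    hT.continuous (by fun_prop) hT.abs_apply_le
    (fun x v hx => by rw [hT.of_one_le hx, hT₁]) (fun x v hx => by rw [hT.of_le_neg_one hx, hT₂])
  have hy : ∀ y : Cylinder, ‖(y.1 : ℂ)‖ ≤ 1 := fun y => mem_closedBall_zero_iff.1 y.1.2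
  refine ⟨fun y => (⟨(coneMap T (fun x => (h (cut (clamp x.1), x.2)).2) ε (y.1, y.2)).1, ?_⟩,
    ⟨(coneMap T (fun x => (h (cut (clamp x.1), x.2)).2) ε (y.1, y.2)).2, ?_⟩), ?_, fun y => rfl⟩
  · rw [mem_closedBall_zero_iff, norm_coneMap_fst]
    exact hy y
  · exact abs_le.1 (abs_coneMap_snd_le hε hT.abs_apply_le (hy y) (abs_le.2 y.2.2))
  · have c' : Continuous fun y : Cylinder => ((y.1 : ℂ), (y.2 : ℝ)) := by fun_prop
    exact Continuous.prodMk (Continuous.subtype_mk (continuous_fst.comp (c.comp c')) _)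
      (Continuous.subtype_mk (continuous_snd.comp (c.comp c')) _)

/-- On both bases the cone map is the same map of the disc, the radial extension of `h` on the
meridian, and `ε` at most exchanges the bases. So identified points stay identified. -/
theorem coneMap_fibres {h : Torus ≃ₜ Torus} {T : ℝ × Circle → ℝ} {ε : ℝ} (hε : ε * ε = 1)
    {F : Cylinder → Cylinder} (hF : ∀ y, (((F y).1 : ℂ), ((F y).2 : ℝ)) =
        coneMap T (fun x => (h (cut (clamp x.1), x.2)).2) ε ((y.1 : ℂ), (y.2 : ℝ)))
    {x y : Cylinder} (hxy : x.toSolidTorus = y.toSolidTorus) :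
    (F x).toSolidTorus = (F y).toSolidTorus := by
  obtain ⟨x, s⟩ := x
  obtain ⟨y, t⟩ := y
  obtain ⟨h1, h2⟩ := Prod.ext_iff.1 hxy
  simp only [Cylinder.toSolidTorus] at h1 h2
  subst h2
  by_cases hs : |(s : ℝ)| < 1
  · rw [Subtype.ext (cut_injOn h1 hs (abs_le.2 t.2))]
  by_cases ht : |(t : ℝ)| < 1
  · rw [Subtype.ext (cut_injOn h1.symm ht (abs_le.2 s.2))]
  have hx : ‖(x : ℂ)‖ ≤ 1 := mem_closedBall_zero_iff.1 x.2
  have key : ∀ s : Set.Icc (-1 : ℝ) 1, ¬ |(s : ℝ)| < 1 → cut (F (x, s)).2 = 1 ∧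
      ((F (x, s)).1 : ℂ) = ‖(x : ℂ)‖ * (h (1, direction x)).2 := by
    intro s hs
    have hs' : (s : ℝ) = 1 ∨ (s : ℝ) = -1 :=
      eq_or_eq_neg_of_abs_eq (le_antisymm (abs_le.2 s.2) (not_lt.1 hs))
    have e1 := congrArg Prod.fst (hF (x, s))
    have e2 := congrArg Prod.snd (hF (x, s))
    simp only at e1 e2
    constructor
    · rw [e2, coneMap, if_pos (hx.trans (not_lt.1 hs))]
      rcases hs' with h | h <;> rcases mul_self_eq_one_iff.1 hε with h' | h' <;>
        simp [h, h', cut_one, cut_neg_one]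
    · rw [e1, coneMap]
      simp only [Complex.real_smul]
      by_cases hx0 : ‖(x : ℂ)‖ = 0
      · simp [hx0]
      have hpos : 0 < ‖(x : ℂ)‖ := lt_of_le_of_ne (norm_nonneg _) (Ne.symm hx0)
      congr 4
      rcases hs' with h | h
      · rw [h, clamp_of_one_le, cut_one]
        rwa [one_le_div hpos]
      · rw [h, clamp_of_le_neg_one, cut_neg_one]
        rw [div_le_iff₀ hpos]
        linarith
  obtain ⟨a1, a2⟩ := key s hs
  obtain ⟨b1, b2⟩ := key t ht
  exact Prod.ext (a1.trans b1.symm) (Subtype.ext (a2.trans b2.symm))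

/-- A homeomorphism of the torus that preserves the meridian extends over the solid torus. -/
theorem exists_extension (h : Torus ≃ₜ Torus) (hM : ∀ t, (h t).1 = 1 ↔ t.1 = 1) :
    ∃ H : SolidTorus ≃ₜ SolidTorus, ∀ t, H (boundary t) = boundary (h t) := by
  obtain ⟨T, T', ε, hε, hT, hT', e₁, e₂, e₁', e₂'⟩ := exists_isAnnulusLift_symm h hM
  obtain ⟨F, F_cont, hF⟩ := exists_cylinder_map hε hT e₁ e₂
  obtain ⟨F', F'_cont, hF'⟩ := exists_cylinder_map hε hT' e₁' e₂'
  -- Stated for a general `h`, so that it serves for both compositions, with `h` and with `h.symm`.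
  have inv : ∀ {h : Torus ≃ₜ Torus} {T T' : ℝ × Circle → ℝ} (_ : IsAnnulusLift h T)
      (_ : IsAnnulusLift h.symm T') (_ : ∀ v, T (1, v) = ε) (_ : ∀ v, T (-1, v) = -ε)
      (_ : ∀ v, T' (1, v) = ε) (_ : ∀ v, T' (-1, v) = -ε) (y : ℂ × ℝ),
      coneMap T' (fun x => (h.symm (cut (clamp x.1), x.2)).2) ε
        (coneMap T (fun x => (h (cut (clamp x.1), x.2)).2) ε y) = y := by
    intro h T T' hT hT' e₁ e₂ e₁' e₂' y
    refine coneMap_coneMap hε hT.abs_apply_le (fun x v hx => by rw [hT.of_one_le hx, e₁])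
      (fun x v hx => by rw [hT.of_le_neg_one hx, e₂]) (fun x v hx => by rw [hT'.of_one_le hx, e₁'])
      (fun x v hx => by rw [hT'.of_le_neg_one hx, e₂']) (κ' := fun v => (h.symm (1, v)).2) ?_
      (hT.apply_apply hT') ?_ y
    · intro x v hx
      rcases le_abs.1 hx with hx | hx
      · simp only [clamp_of_one_le hx, cut_one]
      · simp only [clamp_of_le_neg_one (show x ≤ -1 by linarith), cut_neg_one]
    · intro x v
      simp only
      rw [clamp_of_abs_le (hT.abs_apply_le x v), hT.cut_apply, Prod.mk.eta, h.symm_apply_apply]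
  have inj : ∀ y y' : Cylinder, ((y.1 : ℂ), (y.2 : ℝ)) = ((y'.1 : ℂ), (y'.2 : ℝ)) → y = y' := by
    intro y y' hy
    obtain ⟨h1, h2⟩ := Prod.ext_iff.1 hy
    exact Prod.ext (Subtype.ext h1) (Subtype.ext h2)
  have hF'F : ∀ y, F' (F y) = y := by
    intro y
    apply inj
    rw [hF', hF, inv hT hT' e₁ e₂ e₁' e₂']
  have hFF' : ∀ y, F (F' y) = y := by
    intro y
    apply inj
    rw [hF, hF']
    exact inv (h := h.symm) hT' hT e₁' e₂' e₁ e₂ _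
  obtain ⟨H, hH⟩ := exists_homeomorph_of_isQuotientMap Cylinder.isQuotientMap_toSolidTorus
    Cylinder.isQuotientMap_toSolidTorus ⟨⟨F, F', hF'F, hFF'⟩, F_cont, F'_cont⟩ fun x y =>
      ⟨fun hxy => coneMap_fibres hε hF hxy, fun hxy => by
        have := coneMap_fibres hε hF' hxy
        simpa [hF'F] using this⟩
  refine ⟨H, ?_⟩
  rintro ⟨u, v⟩
  obtain ⟨x, hx, rfl⟩ := cut_surjective u
  have hv : ‖(v : ℂ)‖ = 1 := Circle.norm_coe v
  let y : Cylinder := (⟨v, mem_closedBall_zero_iff.2 hv.le⟩, ⟨x, abs_le.1 hx⟩)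
  have hy : boundary (cut x, v) = y.toSolidTorus := rfl
  rw [hy, hH]
  have e1 := hF y
  -- On the lateral surface `‖z‖ = 1` the cone map reduces to `T` and `h` themselves.
  have hd : direction v = v := by
    have := direction_mul one_pos v
    simpa using this
  have e2 : |(x : ℝ)| ≤ ‖(v : ℂ)‖ := by rwa [hv]
  have e3 := coneMap_snd_of_le (T := T) (ε := ε) (k := fun x => (h (cut (clamp x.1), x.2)).2)
    (fun x v hx => by rw [hT.of_one_le hx, e₁])
    (fun x v hx => by rw [hT.of_le_neg_one hx, e₂]) (y := ((v : ℂ), x)) e2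
  simp only [hv, div_one, hd, one_mul] at e3
  obtain ⟨e4, e5⟩ := Prod.ext_iff.1 e1
  refine Prod.ext ?_ (Subtype.ext ?_)
  · change cut (F y).2 = _
    simp only at e5
    rw [e5, e3, hT.cut_apply, clamp_of_abs_le hx]
    rfl
  · change ((F y).1 : ℂ) = _
    simp only at e4
    rw [e4]
    simp only [coneMap, y, hv, div_one, hd, one_smul, clamp_of_abs_le hx]
    rfl

/-! ### Gluing two solid tori -/

/-- Two solid tori glued along a homeomorphism of their boundaries. -/
abbrev GluedTori (f : Torus ≃ₜ Torus) : Type := Quot (LensSpace.Rel f)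

/-- A homeomorphism that preserves relations in both directions descends to the quotients. -/
def quotHomeomorph {X Y : Type*} [TopologicalSpace X] [TopologicalSpace Y] {r : X → X → Prop}
    {r' : Y → Y → Prop} (F : X ≃ₜ Y) (h : ∀ x y, r x y → r' (F x) (F y))
    (h' : ∀ x y, r' x y → r (F.symm x) (F.symm y)) : Quot r ≃ₜ Quot r' where
  toFun := Quot.map F h
  invFun := Quot.map F.symm h'
  left_inv := by rintro ⟨x⟩; simp [Quot.map]
  right_inv := by rintro ⟨x⟩; simp [Quot.map]
  continuous_toFun := continuous_quot_lift _ (continuous_quot_mk.comp F.continuous)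
  continuous_invFun := continuous_quot_lift _ (continuous_quot_mk.comp F.symm.continuous)

/-- The maps `h₁` and `h₂` extend over the two solid tori, and `hf` says that the extensions respect
the identifications. -/
theorem nonempty_gluedTori_homeomorph {f f' h₁ h₂ : Torus ≃ₜ Torus}
    (hM₁ : ∀ t, (h₁ t).1 = 1 ↔ t.1 = 1) (hM₂ : ∀ t, (h₂ t).1 = 1 ↔ t.1 = 1)
    (hf : ∀ t, f' (h₂ t) = h₁ (f t)) : Nonempty (GluedTori f ≃ₜ GluedTori f') := by
  obtain ⟨H₁, hH₁⟩ := exists_extension h₁ hM₁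
  obtain ⟨H₂, hH₂⟩ := exists_extension h₂ hM₂
  refine ⟨quotHomeomorph (Homeomorph.sumCongr H₁ H₂) ?_ ?_⟩
  · rintro _ _ ⟨t⟩
    change LensSpace.Rel f' (Sum.inl (H₁ (boundary (f t)))) (Sum.inr (H₂ (boundary t)))
    rw [hH₁, hH₂, ← hf]
    exact LensSpace.Rel.glue _
  · rintro _ _ ⟨t⟩
    obtain ⟨t, rfl⟩ := h₂.surjective t
    change LensSpace.Rel f (Sum.inl (H₁.symm (boundary (f' (h₂ t)))))
      (Sum.inr (H₂.symm (boundary (h₂ t))))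
    rw [hf, ← hH₁, ← hH₂, H₁.symm_apply_apply, H₂.symm_apply_apply]
    exact LensSpace.Rel.glue _

/-! ### The three-sphere -/

/-- The point of the three-sphere with given coordinates. -/
def sphere3Mk (a b : ℂ) (h : ‖a‖ ^ 2 + ‖b‖ ^ 2 = 1) : Sphere3 :=
  ⟨WithLp.toLp 2 ![a, b], by
    rw [mem_sphere_zero_iff_norm, EuclideanSpace.norm_eq, Real.sqrt_eq_one, Fin.sum_univ_two]
    simpa using h⟩

theorem sphere3_ext {x y : Sphere3} (h₀ : x.1 0 = y.1 0) (h₁ : x.1 1 = y.1 1) : x = y := by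
  refine Subtype.ext (PiLp.ext fun i => ?_)
  fin_cases i
  exacts [h₀, h₁]

theorem continuous_sphere3Mk {X : Type*} [TopologicalSpace X] {f g : X → ℂ} (hf : Continuous f)
    (hg : Continuous g) (h : ∀ x, ‖f x‖ ^ 2 + ‖g x‖ ^ 2 = 1) :
    Continuous fun x => sphere3Mk (f x) (g x) (h x) := by
  refine Continuous.subtype_mk ((PiLp.continuous_toLp 2 _).comp (continuous_pi fun j => ?_)) _
  fin_cases j
  exacts [hf, hg]

theorem sphere3_norm (x : Sphere3) : ‖x.1 0‖ ^ 2 + ‖x.1 1‖ ^ 2 = 1 := by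
  have := x.2
  rwa [mem_sphere_zero_iff_norm, EuclideanSpace.norm_eq, Real.sqrt_eq_one, Fin.sum_univ_two]
    at this

@[simp] theorem sphere3Mk_zero (a b : ℂ) (h : ‖a‖ ^ 2 + ‖b‖ ^ 2 = 1) :
    (sphere3Mk a b h).1 0 = a := rfl

@[simp] theorem sphere3Mk_one (a b : ℂ) (h : ‖a‖ ^ 2 + ‖b‖ ^ 2 = 1) :
    (sphere3Mk a b h).1 1 = b := rfl

theorem continuous_sphere3_coord (i : Fin 2) : Continuous fun x : Sphere3 => x.1 i := by
  fun_prop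

/-- A continuous surjection from a compact space onto a Hausdorff space identifies the quotient
by a relation with the target if it has the fibres of the quotient map. -/
theorem nonempty_quot_homeomorph {X Y : Type*} [TopologicalSpace X] [CompactSpace X]
    [TopologicalSpace Y] [T2Space Y] {r : X → X → Prop} {f : X → Y} (hf : Continuous f)
    (hs : Function.Surjective f) (h : ∀ x y, r x y → f x = f y)
    (h' : ∀ x y, f x = f y → Quot.mk r x = Quot.mk r y) : Nonempty (Quot r ≃ₜ Y) := by
  obtain ⟨G, -⟩ := exists_homeomorph_of_isQuotientMap (isQuotientMap_quot_mk (r := r))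
    (hf.isClosedMap.isQuotientMap hf hs) (Homeomorph.refl X) fun x y =>
      ⟨fun hxy => congrArg (Quot.lift f h) hxy, h' x y⟩
  exact ⟨G⟩

/-- The three-sphere is the union of two solid tori, in each of which one coordinate of a point
is at most as large as the other one. -/
def sphere3Chart (x : SolidTorus) : ℂ × ℂ :=
  ((√(1 - ‖(x.2 : ℂ)‖ ^ 2 / 2) : ℝ) * (x.1 : ℂ), ((√(1 / 2) : ℝ) : ℂ) * (x.2 : ℂ))

theorem continuous_sphere3Chart : Continuous sphere3Chart := by unfold sphere3Chart; fun_prop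

theorem norm_sphere3Chart_fst (x : SolidTorus) :
    ‖(sphere3Chart x).1‖ ^ 2 = 1 - ‖(x.2 : ℂ)‖ ^ 2 / 2 := by
  have h := norm_le_one x
  have h' : 0 ≤ 1 - ‖(x.2 : ℂ)‖ ^ 2 / 2 := by nlinarith [norm_nonneg (x.2 : ℂ)]
  rw [sphere3Chart, norm_mul, Circle.norm_coe, mul_one, Complex.norm_real, Real.norm_eq_abs, sq_abs,
    Real.sq_sqrt h']

theorem norm_sphere3Chart_snd (x : SolidTorus) :
    ‖(sphere3Chart x).2‖ ^ 2 = ‖(x.2 : ℂ)‖ ^ 2 / 2 := by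
  rw [sphere3Chart, norm_mul, Complex.norm_real, Real.norm_eq_abs, mul_pow, sq_abs,
    Real.sq_sqrt (by norm_num)]
  ring

theorem sphere3Chart_injective : Function.Injective sphere3Chart := by
  rintro ⟨u, z⟩ ⟨v, w⟩ h
  obtain ⟨h1, h2⟩ := Prod.ext_iff.1 h
  simp only [sphere3Chart] at h1 h2
  have hs : ((√(1 / 2) : ℝ) : ℂ) ≠ 0 := Complex.ofReal_ne_zero.2 (by positivity)
  have hzw : z = w := Subtype.ext (mul_left_cancel₀ hs h2)
  subst hzw
  have hz : ‖(z : ℂ)‖ ≤ 1 := norm_le_one (u, z)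
  have hpos : 0 < √(1 - ‖(z : ℂ)‖ ^ 2 / 2) :=
    Real.sqrt_pos.2 (by nlinarith [norm_nonneg (z : ℂ)])
  rw [Circle.ext (mul_left_cancel₀ (Complex.ofReal_ne_zero.2 hpos.ne') h1)]

theorem sphere3Chart_boundary (t : Torus) :
    sphere3Chart (boundary t) = (((√(1 / 2) : ℝ) : ℂ) * t.1, ((√(1 / 2) : ℝ) : ℂ) * t.2) := by
  simp only [sphere3Chart, boundary, Circle.norm_coe]
  norm_num

theorem exists_sphere3Chart {a b : ℂ} (h : ‖a‖ ^ 2 + ‖b‖ ^ 2 = 1) (hb : ‖b‖ ^ 2 ≤ 1 / 2) :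
    ∃ x, sphere3Chart x = (a, b) := by
  have e : ‖((√2 : ℝ) : ℂ) * b‖ ^ 2 = 2 * ‖b‖ ^ 2 := by
    rw [norm_mul, Complex.norm_real, Real.norm_eq_abs, mul_pow, sq_abs, Real.sq_sqrt (by norm_num)]
  refine ⟨(direction a, ⟨((√2 : ℝ) : ℂ) * b, ?_⟩), Prod.ext ?_ ?_⟩
  · rw [mem_closedBall_zero_iff]
    nlinarith [norm_nonneg (((√2 : ℝ) : ℂ) * b)]
  · simp only [sphere3Chart]
    rw [e, show 1 - 2 * ‖b‖ ^ 2 / 2 = ‖a‖ ^ 2 by linarith, Real.sqrt_sq (norm_nonneg a)]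
    exact norm_mul_direction a
  · simp only [sphere3Chart]
    rw [← mul_assoc, ← Complex.ofReal_mul, ← Real.sqrt_mul (by norm_num)]
    norm_num

/-- The Clifford torus `|z| = |w|` cuts the sphere into two solid tori, and the meridian of each is
a longitude of the other. -/
theorem nonempty_gluedTori_prodComm_homeomorph :
    Nonempty (GluedTori (Homeomorph.prodComm Circle Circle) ≃ₜ Sphere3) := by
  have hn : ∀ x, ‖(sphere3Chart x).1‖ ^ 2 + ‖(sphere3Chart x).2‖ ^ 2 = 1 := fun x => by
    rw [norm_sphere3Chart_fst, norm_sphere3Chart_snd]; ring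
  have hn' : ∀ x, ‖(sphere3Chart x).2‖ ^ 2 + ‖(sphere3Chart x).1‖ ^ 2 = 1 := fun x => by
    rw [add_comm, hn]
  have cross : ∀ x y, (sphere3Chart x).1 = (sphere3Chart y).2 →
      (sphere3Chart x).2 = (sphere3Chart y).1 →
      Quot.mk (LensSpace.Rel (Homeomorph.prodComm Circle Circle)) (Sum.inl x) =
        Quot.mk _ (Sum.inr y) := by
    intro x y h1 h2
    have e1 := norm_sphere3Chart_fst x
    rw [h1, norm_sphere3Chart_snd] at e1
    have hx := norm_le_one x
    have hy := norm_le_one y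
    -- `e1` says that the squared norms of `x.2` and `y.2` add up to `2`, and each is at most `1`.
    have hx1 : ‖(x.2 : ℂ)‖ = 1 := by nlinarith [norm_nonneg (x.2 : ℂ), norm_nonneg (y.2 : ℂ)]
    have hy1 : ‖(y.2 : ℂ)‖ = 1 := by nlinarith [norm_nonneg (x.2 : ℂ), norm_nonneg (y.2 : ℂ)]
    have bd : ∀ x : SolidTorus, ‖(x.2 : ℂ)‖ = 1 → ∃ t, x = boundary t := fun x hx =>
      ⟨(x.1, ⟨x.2, mem_sphere_zero_iff_norm.2 hx⟩), rfl⟩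
    obtain ⟨s, rfl⟩ := bd x hx1
    obtain ⟨t, rfl⟩ := bd y hy1
    rw [sphere3Chart_boundary, sphere3Chart_boundary] at h1 h2
    have hs : ((√(1 / 2) : ℝ) : ℂ) ≠ 0 := Complex.ofReal_ne_zero.2 (by positivity)
    have hst : s = Homeomorph.prodComm Circle Circle t := Prod.ext
      (Circle.ext (mul_left_cancel₀ hs h1)) (Circle.ext (mul_left_cancel₀ hs h2))
    rw [hst]
    exact Quot.sound (LensSpace.Rel.glue t)
  have c := continuous_sphere3Chart
  refine nonempty_quot_homeomorph (f := Sum.elim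
    (fun x => sphere3Mk (sphere3Chart x).1 (sphere3Chart x).2 (hn x))
    (fun x => sphere3Mk (sphere3Chart x).2 (sphere3Chart x).1 (hn' x))) ?_ ?_ ?_ ?_
  · exact (continuous_sphere3Mk (by fun_prop) (by fun_prop) _).sumElim
      (continuous_sphere3Mk (by fun_prop) (by fun_prop) _)
  · intro y
    have hy := sphere3_norm y
    by_cases h : ‖y.1 1‖ ^ 2 ≤ 1 / 2
    · obtain ⟨x, hx⟩ := exists_sphere3Chart hy h
      exact ⟨Sum.inl x, sphere3_ext (congrArg Prod.fst hx) (congrArg Prod.snd hx)⟩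
    · obtain ⟨x, hx⟩ := exists_sphere3Chart ((add_comm _ _).trans hy) (by linarith)
      exact ⟨Sum.inr x, sphere3_ext (congrArg Prod.snd hx) (congrArg Prod.fst hx)⟩
  · rintro _ _ ⟨t⟩
    apply sphere3_ext <;> simp [sphere3Chart_boundary]
  · rintro (x | x) (y | y) h <;>
      have h1 := congrArg (fun p : Sphere3 => p.1 0) h <;>
      have h2 := congrArg (fun p : Sphere3 => p.1 1) h <;>
      simp only [Sum.elim_inl, Sum.elim_inr, sphere3Mk_zero, sphere3Mk_one] at h1 h2
    · rw [sphere3Chart_injective (Prod.ext h1 h2)]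
    · exact cross x y h1 h2
    · exact (cross y x h1.symm h2.symm).symm
    · rw [sphere3Chart_injective (Prod.ext h2 h1)]

/-! ### The product of the two-sphere and the circle -/

/-- The point of the two-sphere over a point of the unit disc, with third coordinate of sign `σ`. -/
def sphere2Mk (σ : ℝ) (hσ : σ ^ 2 = 1) (z : Metric.closedBall (0 : ℂ) 1) : Sphere2 :=
  ⟨WithLp.toLp 2 ![(z : ℂ).re, (z : ℂ).im, σ * √(1 - ‖(z : ℂ)‖ ^ 2)], by
    have h : ‖(z : ℂ)‖ ≤ 1 := mem_closedBall_zero_iff.1 z.2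
    have h' : 0 ≤ 1 - ‖(z : ℂ)‖ ^ 2 := by nlinarith [norm_nonneg (z : ℂ)]
    rw [mem_sphere_zero_iff_norm, EuclideanSpace.norm_eq, Real.sqrt_eq_one, Fin.sum_univ_three]
    have e := Complex.sq_norm (z : ℂ)
    rw [Complex.normSq_apply] at e
    simp [mul_pow, hσ, Real.sq_sqrt h']
    nlinarith⟩

theorem continuous_sphere2Mk (σ : ℝ) (hσ : σ ^ 2 = 1) : Continuous (sphere2Mk σ hσ) := by
  refine Continuous.subtype_mk ((PiLp.continuous_toLp 2 _).comp (continuous_pi fun j => ?_)) _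
  fin_cases j
  · exact Complex.continuous_re.comp continuous_subtype_val
  · exact Complex.continuous_im.comp continuous_subtype_val
  · show Continuous fun z : Metric.closedBall (0 : ℂ) 1 => σ * √(1 - ‖(z : ℂ)‖ ^ 2)
    fun_prop

theorem sphere2Mk_inj {σ τ : ℝ} {hσ : σ ^ 2 = 1} {hτ : τ ^ 2 = 1}
    {z w : Metric.closedBall (0 : ℂ) 1} (h : sphere2Mk σ hσ z = sphere2Mk τ hτ w) :
    z = w ∧ σ * √(1 - ‖(z : ℂ)‖ ^ 2) = τ * √(1 - ‖(w : ℂ)‖ ^ 2) := by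
  refine ⟨Subtype.ext (Complex.ext ?_ ?_), ?_⟩
  · exact congrArg (fun p : Sphere2 => p.1 0) h
  · exact congrArg (fun p : Sphere2 => p.1 1) h
  · exact congrArg (fun p : Sphere2 => p.1 2) h

theorem exists_sphere2Mk {σ : ℝ} (hσ : σ ^ 2 = 1) (y : Sphere2) (hy : 0 ≤ σ * y.1 2) :
    ∃ z, sphere2Mk σ hσ z = y := by
  have h := y.2
  rw [mem_sphere_zero_iff_norm, EuclideanSpace.norm_eq, Real.sqrt_eq_one, Fin.sum_univ_three] at h
  simp only [Real.norm_eq_abs, sq_abs] at h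
  have e : ‖(⟨y.1 0, y.1 1⟩ : ℂ)‖ ^ 2 = y.1 0 ^ 2 + y.1 1 ^ 2 := by
    rw [Complex.sq_norm, Complex.normSq_mk]; ring
  refine ⟨⟨⟨y.1 0, y.1 1⟩, ?_⟩, Subtype.ext (PiLp.ext fun i => ?_)⟩
  · rw [mem_closedBall_zero_iff]
    nlinarith [norm_nonneg (⟨y.1 0, y.1 1⟩ : ℂ), sq_nonneg (y.1 2)]
  · fin_cases i
    · rfl
    · rfl
    · show σ * √(1 - ‖(⟨y.1 0, y.1 1⟩ : ℂ)‖ ^ 2) = y.1 2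
      rw [e, show 1 - (y.1 0 ^ 2 + y.1 1 ^ 2) = (σ * y.1 2) ^ 2 by rw [mul_pow, hσ]; linarith,
        Real.sqrt_sq hy, ← mul_assoc, ← sq, hσ, one_mul]

/-- The meridian discs of the two solid tori become the upper and the lower hemisphere, glued along
the equator, while the circle factor is kept. -/
theorem nonempty_gluedTori_refl_homeomorph :
    Nonempty (GluedTori (Homeomorph.refl Torus) ≃ₜ Sphere2 × Circle) := by
  have c₁ := continuous_sphere2Mk 1 (by norm_num)
  have c₂ := continuous_sphere2Mk (-1) (by norm_num)
  have cross : ∀ x y : SolidTorus, sphere2Mk 1 (by norm_num) x.2 = sphere2Mk (-1) (by norm_num) y.2 →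
      x.1 = y.1 → Quot.mk (LensSpace.Rel (Homeomorph.refl Torus)) (Sum.inl x) =
        Quot.mk _ (Sum.inr y) := by
    rintro ⟨u, z⟩ ⟨v, w⟩ h h1
    obtain ⟨h2, h3⟩ := sphere2Mk_inj h
    simp only at h1 h2 h3
    subst h1 h2
    -- A common point of the two hemispheres has third coordinate equal to its own negative, so it
    -- lies on the equator.
    have h4 : √(1 - ‖(z : ℂ)‖ ^ 2) = 0 := by linarith
    have hz : ‖(z : ℂ)‖ ≤ 1 := norm_le_one (u, z)
    have h5 : ‖(z : ℂ)‖ = 1 := by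
      have := (Real.sqrt_eq_zero (by nlinarith [norm_nonneg (z : ℂ)])).1 h4
      nlinarith [norm_nonneg (z : ℂ)]
    exact Quot.sound (LensSpace.Rel.glue (u, ⟨z, mem_sphere_zero_iff_norm.2 h5⟩))
  refine nonempty_quot_homeomorph (f := Sum.elim
    (fun x => (sphere2Mk 1 (by norm_num) x.2, x.1))
    (fun x => (sphere2Mk (-1) (by norm_num) x.2, x.1))) ?_ ?_ ?_ ?_
  · exact Continuous.sumElim (by fun_prop) (by fun_prop)
  · rintro ⟨y, u⟩
    rcases le_total 0 (y.1 2) with h | h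
    · obtain ⟨z, rfl⟩ := exists_sphere2Mk (σ := 1) (by norm_num) y (by linarith)
      exact ⟨Sum.inl (u, z), rfl⟩
    · obtain ⟨z, rfl⟩ := exists_sphere2Mk (σ := -1) (by norm_num) y (by linarith)
      exact ⟨Sum.inr (u, z), rfl⟩
  · rintro _ _ ⟨t⟩
    have ht : ‖(t.2 : ℂ)‖ = 1 := Circle.norm_coe _
    simp [boundary, sphere2Mk, ht]
  · rintro (x | x) (y | y) h <;> obtain ⟨h1, h2⟩ := Prod.ext_iff.1 h <;>
      simp only [Sum.elim_inl, Sum.elim_inr] at h1 h2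
    · rw [Prod.ext h2 (sphere2Mk_inj h1).1]
    · exact cross x y h1 h2
    · exact (cross y x h1.symm h2.symm).symm
    · rw [Prod.ext h2 (sphere2Mk_inj h1).1]

/-! ### The exterior of the Hopf link -/

/-- The radial retraction of the complex plane onto the unit disc. -/
def projDisc (w : ℂ) : Metric.closedBall (0 : ℂ) 1 :=
  ⟨(max 1 ‖w‖)⁻¹ • w, by
    rw [mem_closedBall_zero_iff, norm_smul, norm_inv, Real.norm_of_nonneg (by positivity),
      inv_mul_le_one₀ (by positivity)]
    exact le_max_right _ _⟩

theorem continuous_projDisc : Continuous projDisc := by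
  have h : Continuous fun w : ℂ => (max 1 ‖w‖)⁻¹ :=
    Continuous.inv₀ (by fun_prop) fun w => by positivity
  exact Continuous.subtype_mk (h.smul continuous_id) _

theorem projDisc_of_norm_le {w : ℂ} (hw : ‖w‖ ≤ 1) :
    projDisc w = ⟨w, mem_closedBall_zero_iff.2 hw⟩ := by
  refine Subtype.ext ?_
  simp [projDisc, max_eq_left hw]

theorem projDisc_coe (z : Metric.closedBall (0 : ℂ) 1) : projDisc z = z :=
  projDisc_of_norm_le (mem_closedBall_zero_iff.1 z.2)

/-- Each open neighbourhood consists of the points whose other coordinate has norm less than `1/2`.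
-/
theorem mem_hopfLink_exterior (x : Sphere3) :
    (∀ i, x ∉ hopfLink.nbhd i '' openSolidTorus) ↔ 1 / 4 ≤ ‖x.1 0‖ ^ 2 ∧ 1 / 4 ≤ ‖x.1 1‖ ^ 2 := by
  have hx := sphere3_norm x
  constructor
  · intro h
    have key : ∀ i j : Fin 2, j ≠ i → ‖x.1 i‖ ^ 2 + ‖x.1 j‖ ^ 2 = 1 → 1 / 4 ≤ ‖x.1 j‖ ^ 2 := by
      intro i j hij hn
      by_contra! hlt
      have e : ‖2 * x.1 j‖ = 2 * ‖x.1 j‖ := by rw [norm_mul]; norm_num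
      have hlt' : ‖2 * x.1 j‖ < 1 := by
        rw [e]
        nlinarith [norm_nonneg (x.1 j)]
      refine h i ⟨(direction (x.1 i), ⟨2 * x.1 j, mem_closedBall_zero_iff.2 hlt'.le⟩), hlt', ?_⟩
      have ei : (hopfNbhd i (direction (x.1 i),
          ⟨2 * x.1 j, mem_closedBall_zero_iff.2 hlt'.le⟩)).1 i = x.1 i := by
        rw [hopfNbhd_self]
        simp only
        rw [e, show 1 - (2 * ‖x.1 j‖) ^ 2 / 4 = ‖x.1 i‖ ^ 2 by linarith,
          Real.sqrt_sq (norm_nonneg _)]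
        exact norm_mul_direction _
      have ej : (hopfNbhd i (direction (x.1 i),
          ⟨2 * x.1 j, mem_closedBall_zero_iff.2 hlt'.le⟩)).1 j = x.1 j := by
        rw [hopfNbhd_other hij]
        simp
      refine Subtype.ext (PiLp.ext fun l => ?_)
      by_cases hl : l = i
      · rw [hl]; exact ei
      · rw [show l = j by omega]; exact ej
    exact ⟨key 1 0 (by decide) (by linarith), key 0 1 (by decide) hx⟩
  · rintro ⟨h0, h1⟩ i ⟨y, hy, rfl⟩
    have hy' : ‖(y.2 : ℂ)‖ < 1 := hy
    have key : ∀ j : Fin 2, j ≠ i → ¬ 1 / 4 ≤ ‖(hopfLink.nbhd i y).1 j‖ ^ 2 := by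
      intro j hj h
      have e : (hopfLink.nbhd i y).1 j = (y.2 : ℂ) / 2 := hopfNbhd_other hj y
      rw [e, norm_div, Complex.norm_ofNat] at h
      nlinarith [norm_nonneg (y.2 : ℂ)]
    fin_cases i
    · exact key 1 (by decide) h1
    · exact key 0 (by decide) h0

/-- The point of the exterior of the Hopf link on the torus `|w|² = r - 1/4`, with given
arguments of the coordinates. -/
def exteriorMk (t : Torus) (r : Set.Icc (1 / 2 : ℝ) 1) : hopfLink.Exterior :=
  ⟨sphere3Mk ((√(5 / 4 - r) : ℝ) * t.1) ((√(r - 1 / 4) : ℝ) * t.2) (by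
      have := r.2.1
      have := r.2.2
      rw [norm_mul, norm_mul, Circle.norm_coe, Circle.norm_coe, Complex.norm_real,
        Complex.norm_real, Real.norm_eq_abs, Real.norm_eq_abs, mul_one, mul_one, sq_abs, sq_abs,
        Real.sq_sqrt (by linarith), Real.sq_sqrt (by linarith)]
      ring), by
    have := r.2.1
    have := r.2.2
    rw [mem_hopfLink_exterior, sphere3Mk_zero, sphere3Mk_one, norm_mul, norm_mul, Circle.norm_coe,
      Circle.norm_coe, Complex.norm_real, Complex.norm_real, Real.norm_eq_abs, Real.norm_eq_abs,
      mul_one, mul_one, sq_abs, sq_abs, Real.sq_sqrt (by linarith), Real.sq_sqrt (by linarith)]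
    constructor <;> linarith⟩

theorem continuous_exteriorMk :
    Continuous fun x : Torus × Set.Icc (1 / 2 : ℝ) 1 => exteriorMk x.1 x.2 :=
  Continuous.subtype_mk (continuous_sphere3Mk (by fun_prop) (by fun_prop) _) _

/-- The arguments of the coordinates of a point. -/
def angles (x : hopfLink.Exterior) : Torus := (direction (x.1.1 0), direction (x.1.1 1))

/-- The radial coordinate of a point in the exterior of the Hopf link. -/
def radius (x : hopfLink.Exterior) : Set.Icc (1 / 2 : ℝ) 1 :=
  ⟨‖x.1.1 1‖ ^ 2 + 1 / 4, by
    have h := (mem_hopfLink_exterior x.1).1 x.2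
    have := sphere3_norm x.1
    constructor <;> linarith [h.1, h.2]⟩

theorem continuous_exterior_coord (i : Fin 2) :
    Continuous fun x : hopfLink.Exterior => x.1.1 i :=
  (continuous_sphere3_coord i).comp continuous_subtype_val

theorem continuous_angles : Continuous angles := by
  have key : ∀ i, Continuous fun x : hopfLink.Exterior => direction (x.1.1 i) := by
    intro i
    rw [continuous_iff_continuousAt]
    intro x
    refine ContinuousAt.comp (f := fun x : hopfLink.Exterior => x.1.1 i) (x := x)
      (continuousAt_direction ?_) (continuous_exterior_coord i).continuousAt
    have h := (mem_hopfLink_exterior x.1).1 x.2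
    intro h0
    fin_cases i
    · have h' := h.1
      simp only [Fin.zero_eta] at h0
      rw [h0] at h'
      norm_num at h'
    · have h' := h.2
      simp only [Fin.mk_one] at h0
      rw [h0] at h'
      norm_num at h'
  exact (key 0).prodMk (key 1)

theorem continuous_radius : Continuous radius := by
  have := continuous_exterior_coord 1
  exact Continuous.subtype_mk (by fun_prop) _

theorem exteriorMk_angles_radius (x : hopfLink.Exterior) : exteriorMk (angles x) (radius x) = x := by
  have hx := sphere3_norm x.1
  refine Subtype.ext (sphere3_ext ?_ ?_)
  · simp only [exteriorMk, sphere3Mk_zero, radius, angles]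
    rw [show 5 / 4 - (‖x.1.1 1‖ ^ 2 + 1 / 4) = ‖x.1.1 0‖ ^ 2 by linarith,
      Real.sqrt_sq (norm_nonneg _)]
    exact norm_mul_direction _
  · simp only [exteriorMk, sphere3Mk_one, radius, angles]
    rw [add_sub_cancel_right, Real.sqrt_sq (norm_nonneg _)]
    exact norm_mul_direction _

theorem angles_exteriorMk (t : Torus) (r : Set.Icc (1 / 2 : ℝ) 1) : angles (exteriorMk t r) = t := by
  have := r.2.1
  have := r.2.2
  exact Prod.ext (direction_mul (Real.sqrt_pos.2 (by linarith)) _)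
    (direction_mul (Real.sqrt_pos.2 (by linarith)) _)

theorem radius_exteriorMk (t : Torus) (r : Set.Icc (1 / 2 : ℝ) 1) : radius (exteriorMk t r) = r := by
  have := r.2.1
  refine Subtype.ext ?_
  simp only [radius, exteriorMk, sphere3Mk_one]
  rw [norm_mul, Circle.norm_coe, Complex.norm_real, Real.norm_eq_abs, mul_one, sq_abs,
    Real.sq_sqrt (by linarith), sub_add_cancel]

theorem boundaryTorus_zero (t : Torus) :
    hopfLink.boundaryTorus 0 t = exteriorMk t ⟨1 / 2, by norm_num, by norm_num⟩ := by
  have ht : ‖(t.2 : ℂ)‖ = 1 := Circle.norm_coe _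
  refine Subtype.ext (sphere3_ext ?_ ?_)
  · refine (hopfNbhd_self 0 (boundary t)).trans ?_
    simp only [boundary, ht, exteriorMk, sphere3Mk_zero]
    norm_num
  · refine (hopfNbhd_other (by decide : (1 : Fin 2) ≠ 0) (boundary t)).trans ?_
    simp only [boundary, exteriorMk, sphere3Mk_one]
    rw [show (1 / 2 - 1 / 4 : ℝ) = (1 / 2) ^ 2 by norm_num, Real.sqrt_sq (by norm_num)]
    push_cast
    ring

/-- The swap appears because the second neighbourhood has its coordinates exchanged: a longitude of
one component is a meridian of the other. -/
theorem boundaryTorus_one (t : Torus) :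
    hopfLink.boundaryTorus 1 t = exteriorMk t.swap ⟨1, by norm_num, le_rfl⟩ := by
  have ht : ‖(t.2 : ℂ)‖ = 1 := Circle.norm_coe _
  refine Subtype.ext (sphere3_ext ?_ ?_)
  · refine (hopfNbhd_other (by decide : (0 : Fin 2) ≠ 1) (boundary t)).trans ?_
    simp only [boundary, exteriorMk, sphere3Mk_zero, Prod.fst_swap]
    rw [show (5 / 4 - 1 : ℝ) = (1 / 2) ^ 2 by norm_num, Real.sqrt_sq (by norm_num)]
    push_cast
    ring
  · refine (hopfNbhd_self 1 (boundary t)).trans ?_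
    simp only [boundary, ht, exteriorMk, sphere3Mk_one, Prod.snd_swap]
    norm_num

/-! ### Surgery on the Hopf link as a union of two solid tori -/

section Surgery

variable (g₁ g₂ : Torus ≃ₜ Torus)

/-- The gluing map of the two new solid tori after collapsing the exterior of the Hopf link. -/
def surgeryGluing : Torus ≃ₜ Torus := g₁.trans ((Homeomorph.prodComm Circle Circle).trans g₂.symm)

theorem apply_surgeryGluing (t : Torus) : g₂ (surgeryGluing g₁ g₂ t) = (g₁ t).swap := by
  simp [surgeryGluing]

/-- The first new solid torus and the exterior together form a solid torus. -/
def surgeryToGlued : hopfLink.Exterior ⊕ (Σ _ : Fin 2, SolidTorus) →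
    GluedTori (surgeryGluing g₁ g₂)
  | Sum.inl e => Quot.mk _ (Sum.inr ((g₁.symm (angles e)).1,
      projDisc (((radius e : ℝ) : ℂ) * (g₁.symm (angles e)).2)))
  | Sum.inr ⟨i, x⟩ => Quot.mk _ (if i = 0 then Sum.inr (x.1, projDisc (x.2 / 2)) else Sum.inl x)

theorem continuous_surgeryToGlued : Continuous (surgeryToGlued g₁ g₂) := by
  have c₁ := continuous_projDisc
  have c₂ := continuous_angles
  have c₃ := continuous_radius
  refine continuous_sum_dom.2 ⟨?_, continuous_sigma fun i => ?_⟩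
  · refine continuous_quot_mk.comp (continuous_inr.comp (f := fun e =>
      ((g₁.symm (angles e)).1, projDisc (((radius e : ℝ) : ℂ) * (g₁.symm (angles e)).2))) ?_)
    fun_prop
  · fin_cases i
    · exact continuous_quot_mk.comp (continuous_inr.comp (f := fun x : SolidTorus =>
        (x.1, projDisc (x.2 / 2))) (by fun_prop))
    · exact continuous_quot_mk.comp continuous_inl

/-- The exterior becomes the collar `1/2 ≤ ‖z‖ ≤ 1` of a solid torus, straightened by `g₁⁻¹`, and
the first new solid torus is shrunk into `‖z‖ ≤ 1/2`. They meet at radius `1/2`; the second new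
torus is attached at radius `1`. -/
theorem surgeryToGlued_rel {x y} (h : FramedLink.DehnSurgery.Rel hopfLink ![g₁, g₂] x y) :
    surgeryToGlued g₁ g₂ x = surgeryToGlued g₁ g₂ y := by
  obtain ⟨i, t⟩ := h
  have ht : ‖(t.2 : ℂ)‖ = 1 := Circle.norm_coe _
  fin_cases i
  · change surgeryToGlued g₁ g₂ (Sum.inl (hopfLink.boundaryTorus 0 (g₁ t))) =
      surgeryToGlued g₁ g₂ (Sum.inr ⟨0, boundary t⟩)
    rw [boundaryTorus_zero]
    simp only [surgeryToGlued, angles_exteriorMk, radius_exteriorMk, g₁.symm_apply_apply, boundary,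
      if_true]
    congr 4
    push_cast
    ring
  · change surgeryToGlued g₁ g₂ (Sum.inl (hopfLink.boundaryTorus 1 (g₂ t))) =
      surgeryToGlued g₁ g₂ (Sum.inr ⟨1, boundary t⟩)
    obtain ⟨t, rfl⟩ := (surgeryGluing g₁ g₂).surjective t
    rw [boundaryTorus_one]
    simp only [surgeryToGlued, angles_exteriorMk, radius_exteriorMk, apply_surgeryGluing,
      Prod.swap_swap, g₁.symm_apply_apply, one_ne_zero, if_false]
    rw [Complex.ofReal_one, one_mul]
    have ht' : ‖(t.2 : ℂ)‖ ≤ 1 := (Circle.norm_coe _).le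
    rw [projDisc_of_norm_le ht']
    exact (Quot.sound (LensSpace.Rel.glue t)).symm

/-- The radius of a point in the outer part of a solid torus, extended by a constant. -/
def outerRadius (x : SolidTorus) : Set.Icc (1 / 2 : ℝ) 1 :=
  ⟨max (1 / 2) ‖(x.2 : ℂ)‖, le_max_left _ _, max_le (by norm_num) (norm_le_one x)⟩

/-- The inner part of a solid torus as the first new solid torus. -/
def innerPart (x : SolidTorus) : hopfLink.DehnSurgery ![g₁, g₂] :=
  Quot.mk _ (Sum.inr ⟨0, (x.1, projDisc (2 * x.2))⟩)

/-- The outer part of a solid torus as the exterior of the Hopf link. -/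
def outerPart (x : SolidTorus) : hopfLink.DehnSurgery ![g₁, g₂] :=
  Quot.mk _ (Sum.inl (exteriorMk (g₁ (x.1, direction x.2)) (outerRadius x)))

theorem innerPart_eq_outerPart {x : SolidTorus} (hx : ‖(x.2 : ℂ)‖ = 1 / 2) :
    innerPart g₁ g₂ x = outerPart g₁ g₂ x := by
  have e : (x.1, projDisc (2 * x.2)) = boundary (x.1, direction x.2) := by
    refine Prod.ext rfl ?_
    have h2 : ‖2 * (x.2 : ℂ)‖ ≤ 1 := by rw [norm_mul, hx]; norm_num
    rw [projDisc_of_norm_le h2]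
    refine Subtype.ext ?_
    simp only [boundary]
    have h3 := norm_mul_direction (x.2 : ℂ)
    rw [hx] at h3
    conv_lhs => rw [← h3]
    push_cast
    ring
  have e' : outerRadius x = ⟨1 / 2, by norm_num, by norm_num⟩ := Subtype.ext (by
    simp [outerRadius, hx])
  unfold innerPart outerPart
  rw [e, e', ← boundaryTorus_zero]
  exact (Quot.sound (FramedLink.DehnSurgery.Rel.glue (L := hopfLink) (g := ![g₁, g₂]) 0 _)).symm

/-- The inverse of `surgeryToGlued`. -/
def gluedToSurgery : SolidTorus ⊕ SolidTorus → hopfLink.DehnSurgery ![g₁, g₂]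
  | Sum.inl x => Quot.mk _ (Sum.inr ⟨1, x⟩)
  | Sum.inr x => if ‖(x.2 : ℂ)‖ ≤ 1 / 2 then innerPart g₁ g₂ x else outerPart g₁ g₂ x

theorem gluedToSurgery_inr_of_ge {x : SolidTorus} (hx : ‖(x.2 : ℂ)‖ ≤ 1 / 2) :
    gluedToSurgery g₁ g₂ (Sum.inr x) = innerPart g₁ g₂ x := if_pos hx

theorem gluedToSurgery_inr_of_le {x : SolidTorus} (hx : 1 / 2 ≤ ‖(x.2 : ℂ)‖) :
    gluedToSurgery g₁ g₂ (Sum.inr x) = outerPart g₁ g₂ x := by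
  unfold gluedToSurgery
  simp only
  split_ifs with h
  · exact innerPart_eq_outerPart g₁ g₂ (le_antisymm h hx)
  · rfl

theorem continuous_gluedToSurgery : Continuous (gluedToSurgery g₁ g₂) := by
  have c₁ := continuous_projDisc
  have c₀ : Continuous fun y : SolidTorus => (⟨0, y⟩ : Σ _ : Fin 2, SolidTorus) :=
    continuous_sigmaMk (σ := fun _ : Fin 2 => SolidTorus)
  refine continuous_sum_dom.2 ⟨?_, ?_⟩
  · exact continuous_quot_mk.comp (continuous_inr.comp continuous_sigmaMk)
  refine continuous_if_le (by fun_prop) (by fun_prop) ?_ ?_ fun x hx =>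
    innerPart_eq_outerPart g₁ g₂ hx
  · exact Continuous.continuousOn (continuous_quot_mk.comp (continuous_inr.comp
      (c₀.comp (f := fun x : SolidTorus => (x.1, projDisc (2 * x.2))) (by fun_prop))))
  · have c₂ : Continuous fun y : Torus × Set.Icc (1 / 2 : ℝ) 1 =>
        (Quot.mk _ (Sum.inl (exteriorMk (g₁ y.1) y.2)) : hopfLink.DehnSurgery ![g₁, g₂]) :=
      continuous_quot_mk.comp (continuous_inl.comp (continuous_exteriorMk.comp
        (f := fun y : Torus × Set.Icc (1 / 2 : ℝ) 1 => (g₁ y.1, y.2)) (by fun_prop)))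
    refine c₂.comp_continuousOn (f := fun x : SolidTorus =>
      ((x.1, direction x.2), outerRadius x)) ?_
    -- The direction is discontinuous only at `0`, which lies outside the closed set used here.
    have c₃ : Continuous outerRadius := Continuous.subtype_mk (by fun_prop) _
    refine ContinuousOn.prodMk (ContinuousOn.prodMk (by fun_prop) ?_) c₃.continuousOn
    intro x hx
    refine ContinuousAt.continuousWithinAt (ContinuousAt.comp (f := fun x : SolidTorus =>
      (x.2 : ℂ)) (continuousAt_direction ?_) (by fun_prop))
    intro h0
    have hx' : 1 / 2 ≤ ‖(x.2 : ℂ)‖ := hx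
    rw [h0] at hx'
    norm_num at hx'

theorem gluedToSurgery_rel {x y} (h : LensSpace.Rel (surgeryGluing g₁ g₂) x y) :
    gluedToSurgery g₁ g₂ x = gluedToSurgery g₁ g₂ y := by
  obtain ⟨t⟩ := h
  have ht : ‖((boundary t).2 : ℂ)‖ = 1 := Circle.norm_coe t.2
  rw [gluedToSurgery_inr_of_le _ _ (by rw [ht]; norm_num)]
  have h1 : Quot.mk (FramedLink.DehnSurgery.Rel hopfLink ![g₁, g₂])
      (Sum.inl (hopfLink.boundaryTorus 1 (g₂ (surgeryGluing g₁ g₂ t)))) =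
      gluedToSurgery g₁ g₂ (Sum.inl (boundary (surgeryGluing g₁ g₂ t))) :=
    Quot.sound (FramedLink.DehnSurgery.Rel.glue (L := hopfLink) (g := ![g₁, g₂]) 1 _)
  rw [← h1, boundaryTorus_one, apply_surgeryGluing, Prod.swap_swap, outerPart]
  have e : outerRadius (boundary t) = ⟨1, by norm_num, le_rfl⟩ := Subtype.ext (by
    simp only [outerRadius, ht]; norm_num)
  have e' : direction ((boundary t).2 : ℂ) = t.2 := by
    have := direction_mul one_pos t.2
    rwa [Complex.ofReal_one, one_mul] at this
  rw [e, e']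
  rfl

theorem surgeryToGlued_gluedToSurgery (x : SolidTorus ⊕ SolidTorus) :
    Quot.lift (surgeryToGlued g₁ g₂) (fun _ _ => surgeryToGlued_rel g₁ g₂) (gluedToSurgery g₁ g₂ x) =
      Quot.mk _ x := by
  rcases x with x | x
  · rfl
  by_cases hx : ‖(x.2 : ℂ)‖ ≤ 1 / 2
  · rw [gluedToSurgery_inr_of_ge _ _ hx]
    change Quot.mk _ (Sum.inr (x.1, projDisc ((projDisc (2 * x.2) : ℂ) / 2))) = _
    have h2 : ‖2 * (x.2 : ℂ)‖ ≤ 1 := by rw [norm_mul, Complex.norm_ofNat]; linarith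
    rw [projDisc_of_norm_le h2]
    simp only
    rw [mul_div_cancel_left₀ _ two_ne_zero, projDisc_coe]
  · have hx' := (not_le.1 hx).le
    rw [gluedToSurgery_inr_of_le _ _ hx', outerPart]
    simp only [surgeryToGlued, angles_exteriorMk, radius_exteriorMk, g₁.symm_apply_apply,
      outerRadius, max_eq_right hx', norm_mul_direction, projDisc_coe]

theorem gluedToSurgery_surgeryToGlued (x : hopfLink.Exterior ⊕ (Σ _ : Fin 2, SolidTorus)) :
    Quot.lift (gluedToSurgery g₁ g₂) (fun _ _ => gluedToSurgery_rel g₁ g₂) (surgeryToGlued g₁ g₂ x) =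
      Quot.mk _ x := by
  rcases x with x | ⟨i, x⟩
  · simp only [surgeryToGlued]
    have hr := (radius x).2.1
    have hr0 : (0 : ℝ) < radius x := lt_of_lt_of_le (by norm_num) hr
    have hn : ‖((radius x : ℝ) : ℂ) * (g₁.symm (angles x)).2‖ = radius x := by
      rw [norm_mul, Circle.norm_coe, mul_one, Complex.norm_real, Real.norm_of_nonneg hr0.le]
    rw [projDisc_of_norm_le (hn.trans_le (radius x).2.2), gluedToSurgery_inr_of_le, outerPart]
    · simp only [direction_mul hr0, Prod.mk.eta, g₁.apply_symm_apply]
      congr 2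
      conv_rhs => rw [← exteriorMk_angles_radius x]
      congr 1
      refine Subtype.ext ?_
      simp only [outerRadius, hn, max_eq_right hr]
    · simp only [hn]
      exact hr
  · fin_cases i
    · change gluedToSurgery g₁ g₂ (Sum.inr (x.1, projDisc (x.2 / 2))) = _
      have hx := norm_le_one x
      have h2 : ‖(x.2 : ℂ) / 2‖ ≤ 1 / 2 := by rw [norm_div, Complex.norm_ofNat]; linarith
      rw [projDisc_of_norm_le (h2.trans (by norm_num)), gluedToSurgery_inr_of_ge _ _ h2, innerPart]
      simp only
      rw [mul_div_cancel₀ _ two_ne_zero, projDisc_coe]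
      rfl
    · rfl

/-- Surgery on the Hopf link yields the union of two solid tori. -/
def surgeryHomeomorph : hopfLink.DehnSurgery ![g₁, g₂] ≃ₜ GluedTori (surgeryGluing g₁ g₂) where
  toFun := Quot.lift (surgeryToGlued g₁ g₂) fun _ _ => surgeryToGlued_rel g₁ g₂
  invFun := Quot.lift (gluedToSurgery g₁ g₂) fun _ _ => gluedToSurgery_rel g₁ g₂
  left_inv := by rintro ⟨x⟩; exact gluedToSurgery_surgeryToGlued g₁ g₂ x
  right_inv := by rintro ⟨x⟩; exact surgeryToGlued_gluedToSurgery g₁ g₂ x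
  continuous_toFun := continuous_quot_lift _ (continuous_surgeryToGlued g₁ g₂)
  continuous_invFun := continuous_quot_lift _ (continuous_gluedToSurgery g₁ g₂)

end Surgery

/-! ### Continued fractions and curves on the torus -/

/-- The homogeneous form of the continued fraction `[a₀; a₁, …, aₗ, v.1 / v.2]`. -/
def contVec (v : ℤ × ℤ) (l : List ℤ) : ℤ × ℤ := l.foldr (fun a w => (a * w.1 + w.2, w.1)) v

theorem isCoprime_contVec {v : ℤ × ℤ} (hv : IsCoprime v.1 v.2) (l : List ℤ) :
    IsCoprime (contVec v l).1 (contVec v l).2 := by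
  induction l with
  | nil => exact hv
  | cons a l ih =>
    have h := IsCoprime.add_mul_left_left ih.symm a
    rwa [add_comm, mul_comm] at h

theorem contVec_append (v : ℤ × ℤ) (l l' : List ℤ) :
    contVec v (l ++ l') = contVec (contVec v l') l := List.foldr_append

/-- Coprimality excludes `p = q = 0`, where the right side is `1/0` but the left side is `a`. -/
theorem addInt_recip_frac (a : ℤ) {p q : ℤ} (h : IsCoprime p q) :
    addInt a (recip (frac p q)) = frac (a * p + q) p := by
  unfold frac
  by_cases hq : q = 0
  · have hp : p ≠ 0 := by rintro rfl; exact not_isCoprime_zero_zero (hq ▸ h)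
    rw [if_pos hq, if_neg hp]
    have : (p : ℚ) ≠ 0 := by exact_mod_cast hp
    simp only [recip, addInt]
    subst hq
    congr 1
    push_cast
    field_simp
    ring
  · rw [if_neg hq]
    have hq' : (q : ℚ) ≠ 0 := by exact_mod_cast hq
    by_cases hp : p = 0
    · subst hp
      simp [recip, addInt]
    · have hp' : (p : ℚ) ≠ 0 := by exact_mod_cast hp
      have hpq : (p : ℚ) / q ≠ 0 := div_ne_zero hp' hq'
      rw [if_neg hp]
      simp only [recip, if_neg hpq, addInt]
      congr 1
      push_cast
      field_simp

theorem contFrac_eq_frac (l : List ℤ) :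
    contFrac l = frac (contVec (1, 0) l).1 (contVec (1, 0) l).2 := by
  induction l with
  | nil => simp [contFrac, contVec, frac]
  | cons a l ih =>
    rw [contFrac, ih, addInt_recip_frac a (isCoprime_contVec isCoprime_one_left l)]
    rfl

theorem recip_recip (x : OnePoint ℚ) : recip (recip x) = x := by
  induction x using OnePoint.rec with
  | infty => simp [recip]
  | coe x =>
    by_cases hx : x = 0
    · simp [recip, hx]
    · simp [recip, hx]

theorem addInt_zero (x : OnePoint ℚ) : addInt 0 x = x := by
  induction x using OnePoint.rec with
  | infty => rfl
  | coe x => simp [addInt]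

theorem frac_injective {p q p' q' : ℤ} (h : IsCoprime p q) (h' : IsCoprime p' q')
    (e : frac p q = frac p' q') : (p = p' ∧ q = q') ∨ (p = -p' ∧ q = -q') := by
  unfold frac at e
  by_cases hq : q = 0 <;> by_cases hq' : q' = 0
  · subst hq hq'
    have u := isCoprime_zero_right.1 h
    have u' := isCoprime_zero_right.1 h'
    rcases Int.isUnit_iff.1 u with h | h <;> rcases Int.isUnit_iff.1 u' with h' | h' <;>
      simp [h, h']
  · simp [hq, hq'] at e
  · simp [hq, hq'] at e
  · rw [if_neg hq, if_neg hq', OnePoint.coe_eq_coe] at e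
    have hq1 : (q : ℚ) ≠ 0 := by exact_mod_cast hq
    have hq1' : (q' : ℚ) ≠ 0 := by exact_mod_cast hq'
    rw [div_eq_div_iff hq1 hq1'] at e
    have e' : p * q' = p' * q := by exact_mod_cast e
    have d1 : q ∣ q' := h.symm.dvd_of_dvd_mul_left ⟨p', by rw [e', mul_comm]⟩
    have d2 : q' ∣ q := h'.symm.dvd_of_dvd_mul_left ⟨p, by rw [← e', mul_comm]⟩
    rcases Int.natAbs_eq_natAbs_iff.1 (Nat.dvd_antisymm (Int.natAbs_dvd_natAbs.2 d1)
      (Int.natAbs_dvd_natAbs.2 d2)) with h3 | h3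
    · subst h3
      exact Or.inl ⟨mul_right_cancel₀ hq e', rfl⟩
    · subst h3
      refine Or.inr ⟨mul_right_cancel₀ hq' ?_, rfl⟩
      linarith

/-- The substitution `ζ ↦ ζ⁻¹` reverses the curve. Hence the sign left open by `frac_injective` is
harmless. -/
theorem torusCurve_neg (l m : ℤ) : torusCurve (-l) (-m) = torusCurve l m := by
  ext t
  constructor <;> rintro ⟨ζ, rfl⟩ <;> exact ⟨ζ⁻¹, by simp⟩

theorem torusCurve_swap (l m : ℤ) : Prod.swap '' torusCurve l m = torusCurve m l := by
  rw [torusCurve, ← Set.range_comp]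
  rfl

theorem torusCurve_zero_one : torusCurve 0 1 = {t | t.1 = 1} := by
  ext ⟨u, v⟩
  constructor
  · rintro ⟨ζ, h⟩
    simpa using (congrArg Prod.fst h).symm
  · intro h
    exact ⟨v, Prod.ext (by simpa using h.symm) (by simp)⟩

theorem torusCurve_eq_of_frac_eq {p q p' q' : ℤ} (h : IsCoprime p q) (h' : IsCoprime p' q')
    (e : frac p q = frac p' q') : torusCurve p q = torusCurve p' q' := by
  rcases frac_injective h h' e with ⟨rfl, rfl⟩ | ⟨rfl, rfl⟩
  · rfl
  · exact torusCurve_neg _ _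

/-- The linear homeomorphism of the torus with matrix `!![a, 1; 1, 0]`. -/
def torusStep (a : ℤ) : Torus ≃ₜ Torus where
  toFun t := (t.1 ^ a * t.2, t.1)
  invFun t := (t.2, (t.2 ^ a)⁻¹ * t.1)
  left_inv t := by simp
  right_inv t := by simp
  continuous_toFun := by fun_prop
  continuous_invFun := by fun_prop

/-- The linear homeomorphism of the torus that corresponds to `contVec`. -/
def torusWord : List ℤ → (Torus ≃ₜ Torus)
  | [] => Homeomorph.refl _
  | a :: l => (torusWord l).trans (torusStep a)

theorem image_trans {X Y Z : Type*} [TopologicalSpace X] [TopologicalSpace Y] [TopologicalSpace Z]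
    (f : X ≃ₜ Y) (g : Y ≃ₜ Z) (s : Set X) : f.trans g '' s = g '' (f '' s) :=
  Set.image_comp g f s

theorem torusWord_image (l : List ℤ) (v : ℤ × ℤ) :
    torusWord l '' torusCurve v.1 v.2 = torusCurve (contVec v l).1 (contVec v l).2 := by
  induction l with
  | nil => exact Set.image_id _
  | cons a l ih =>
    rw [torusWord, image_trans, ih, torusCurve, ← Set.range_comp]
    refine congrArg Set.range (funext fun ζ => Prod.ext ?_ rfl)
    change (ζ ^ (contVec v l).1) ^ a * ζ ^ (contVec v l).2 = ζ ^ (a * (contVec v l).1 + (contVec v l).2)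
    rw [← zpow_mul, ← zpow_add, mul_comm]

/-- The identity `M (-x) J (M x) = J` cancels the entries in pairs, from `b 0` on. At the last entry
the added `1` survives: `(bₘ + 1, 1)` is swapped to `(1, bₘ + 1)` and then sent to `(1, 1)`. -/
theorem contVec_reverse_neg {m : ℕ} (b : Fin (m + 1) → ℤ) (v : ℤ × ℤ)
    (hv : v = contVec (1, 0)
      (List.ofFn (Function.update b (Fin.last m) (b (Fin.last m) + 1)))) :
    contVec v.swap (List.ofFn fun i => -b i).reverse = (1, 1) := by
  induction m generalizing v with
  | zero =>
    subst hv
    simp [contVec, Fin.last]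
  | succ m ih =>
    have e : (fun i : Fin (m + 1) => Function.update b (Fin.last (m + 1))
        (b (Fin.last (m + 1)) + 1) i.succ) = Function.update (fun i => b i.succ) (Fin.last m)
          (b (Fin.last m).succ + 1) := by
      funext i
      by_cases hi : i = Fin.last m
      · subst hi
        simp
      · have hi' : i.succ ≠ Fin.last (m + 1) := fun h => hi (Fin.succ_injective _ h)
        simp [hi, hi']
    rw [List.ofFn_succ, e] at hv
    rw [List.ofFn_succ, List.reverse_cons, contVec, List.foldr_append]
    refine Eq.trans ?_ (ih (fun i => b i.succ) _ rfl)
    have h0 : (0 : Fin (m + 2)) ≠ Fin.last (m + 1) := by simp [Fin.ext_iff]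
    rw [Function.update_of_ne h0] at hv
    rw [hv]
    simp only [contVec, List.foldr_cons, List.foldr_nil, Prod.swap]
    congr 2
    ring

/-! ### ### Comparing the surgery with a lens space -/

theorem apply_fst_eq_one_iff {h : Torus ≃ₜ Torus} (hM : h '' {t | t.1 = 1} = {t | t.1 = 1})
    (t : Torus) : (h t).1 = 1 ↔ t.1 = 1 := by
  change h t ∈ {t : Torus | t.1 = 1} ↔ t ∈ {t : Torus | t.1 = 1}
  conv_lhs => rw [← hM]
  exact h.injective.mem_set_image

/-- Surgery on the Hopf link yields a lens space if the two slopes are related to the slope of the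
lens space by a homeomorphism of the torus. -/
theorem nonempty_hopfLinkSurgery_homeomorph {p q r s c d : ℤ} (g₁ : Gluing q p) (g₂ : Gluing s r)
    (g : Gluing c d) (K : Torus ≃ₜ Torus) (h₁ : K '' torusCurve p q = torusCurve c d)
    (h₂ : K '' torusCurve s r = torusCurve 0 1) :
    Nonempty (HopfLinkSurgery g₁ g₂ ≃ₜ LensSpace g) := by
  -- `k₁` acts on the solid torus glued by `g₂`, and `k₂` is forced by the equation `g ∘ k₂ = k₁ ∘
  -- surgeryGluing`. Here `k₁ ∘ surgeryGluing` is `K ∘ swap ∘ g₁`, and the swap turns the class `(q,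
  -- p)` into `(p, q)`.
  let k₁ := g₂.toHomeo.trans K
  let k₂ := ((surgeryGluing g₁.toHomeo g₂.toHomeo).trans k₁).trans g.toHomeo.symm
  have hk₁ : k₁ '' {t | t.1 = 1} = {t | t.1 = 1} := by
    rw [image_trans, g₂.map_meridian, h₂, torusCurve_zero_one]
  have hk₂ : k₂ '' {t | t.1 = 1} = {t | t.1 = 1} := by
    have e : (surgeryGluing g₁.toHomeo g₂.toHomeo).trans k₁ =
        (g₁.toHomeo.trans (Homeomorph.prodComm Circle Circle)).trans K := by
      ext1 t
      exact congrArg K (apply_surgeryGluing _ _ t)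
    have e' : ⇑(Homeomorph.prodComm Circle Circle) = Prod.swap := rfl
    rw [image_trans, e, image_trans, image_trans, g₁.map_meridian, e', torusCurve_swap, h₁,
      ← g.map_meridian, ← Set.image_comp]
    simp
  obtain ⟨F⟩ := nonempty_gluedTori_homeomorph (f := surgeryGluing g₁.toHomeo g₂.toHomeo)
    (f' := g.toHomeo) (apply_fst_eq_one_iff hk₁) (apply_fst_eq_one_iff hk₂)
    (fun t => g.toHomeo.apply_symm_apply _)
  exact ⟨(surgeryHomeomorph _ _).trans F⟩

/-- The homeomorphism is the word of the reversed list of the `-bᵢ`, preceded by a short list `l`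
that moves `(1, 1)` to the meridian and accounts for the exponent and the `-1`. -/
theorem exists_torus_homeomorph {n m : ℕ} {a : Fin (n + 1) → ℤ} {b : Fin (m + 1) → ℤ}
    {p q r s : ℤ} (hpq : IsCoprime p q) (hrs : IsCoprime r s)
    (hp : frac p q = contFrac (List.ofFn a))
    (hr : frac r s =
      contFrac (List.ofFn (Function.update b (Fin.last m) (b (Fin.last m) + 1))))
    {c d : ℤ} (hcd : IsCoprime c d)
    (hc : frac c d = addInt (-1)
      (if Even (m + 1) then contFrac ((List.ofFn fun i => -b i).reverse ++ List.ofFn a)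
        else recip (contFrac ((List.ofFn fun i => -b i).reverse ++ List.ofFn a)))) :
    ∃ K : Torus ≃ₜ Torus, K '' torusCurve p q = torusCurve c d ∧
      K '' torusCurve s r = torusCurve 0 1 := by
  have cop : ∀ l, IsCoprime (contVec (1, 0) l).1 (contVec (1, 0) l).2 :=
    isCoprime_contVec isCoprime_one_left
  obtain ⟨l, hl, hc'⟩ : ∃ l : List ℤ, contVec (1, 1) l = (0, 1) ∧ frac c d =
      contFrac (l ++ ((List.ofFn fun i => -b i).reverse ++ List.ofFn a)) := by
    split_ifs at hc
    -- Prepending `-1` alone would give `1/x - 1`; the entry `0` inserts a second reciprocal, which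
    -- leaves `x - 1`.
    · refine ⟨[-1, 0], by simp [contVec], hc.trans ?_⟩
      rw [List.cons_append, List.cons_append, List.nil_append, contFrac, contFrac, addInt_zero,
        recip_recip]
    · exact ⟨[-1], by simp [contVec], hc⟩
  refine ⟨torusWord (l ++ (List.ofFn fun i => -b i).reverse), ?_, ?_⟩
  · rw [contFrac_eq_frac] at hp hc'
    rw [torusCurve_eq_of_frac_eq hpq (cop _) hp, torusCurve_eq_of_frac_eq hcd (cop _) hc',
      torusWord_image, ← List.append_assoc, contVec_append _ _ (List.ofFn a)]
  · rw [contFrac_eq_frac] at hr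
    have e := torusCurve_eq_of_frac_eq hrs (cop _) hr
    have e' := congrArg (Set.image Prod.swap) e
    rw [torusCurve_swap, torusCurve_swap] at e'
    have e₁ := torusWord_image (l ++ (List.ofFn fun i => -b i).reverse) (contVec (1, 0)
      (List.ofFn (Function.update b (Fin.last m) (b (Fin.last m) + 1)))).swap
    have e₂ := contVec_reverse_neg b _ rfl
    rw [contVec_append, e₂, hl] at e₁
    rw [e']
    exact e₁

end HopfSurgery

end

theorem theorem1p1
    (n m : ℕ) (a : Fin (n + 1) → ℤ) (b : Fin (m + 1) → ℤ) (p q r s : ℤ)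
    (hpq : IsCoprime p q) (hrs : IsCoprime r s)
    (hp : frac p q = contFrac (List.ofFn a))
    (hr : frac r s =
      contFrac (List.ofFn (Function.update b (Fin.last m) (b (Fin.last m) + 1))))
    (c d : ℤ) (hcd : IsCoprime c d)
    (hc : frac c d = addInt (-1)
      (if Even (m + 1) then contFrac ((List.ofFn fun i => -b i).reverse ++ List.ofFn a)
        else recip (contFrac ((List.ofFn fun i => -b i).reverse ++ List.ofFn a))))
    (g₁ : Gluing q p) (g₂ : Gluing s r) :
    (∀ g : Gluing c d, Nonempty (HopfLinkSurgery g₁ g₂ ≃ₜ LensSpace g)) ∧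
      (d = 0 → Nonempty (HopfLinkSurgery g₁ g₂ ≃ₜ Sphere3)) ∧
      (c = 0 → Nonempty (HopfLinkSurgery g₁ g₂ ≃ₜ Sphere2 × Circle)) := by
  obtain ⟨K, h₁, h₂⟩ := exists_torus_homeomorph hpq hrs hp hr hcd hc
  have key : ∀ g : Gluing c d, Nonempty (HopfLinkSurgery g₁ g₂ ≃ₜ LensSpace g) := fun g =>
    nonempty_hopfLinkSurgery_homeomorph g₁ g₂ g K h₁ h₂
  refine ⟨key, ?_, ?_⟩
  -- Here `c = ±1`, so the swap is an admissible gluing map, and it yields the three-sphere.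
  · rintro rfl
    have hM : Homeomorph.prodComm Circle Circle '' {t | t.1 = 1} = torusCurve c 0 := by
      have h : torusCurve c 0 = torusCurve 1 0 := by
        rcases Int.isUnit_iff.1 (isCoprime_zero_right.1 hcd) with rfl | rfl
        · rfl
        · exact torusCurve_neg 1 0
      rw [h, ← torusCurve_zero_one]
      exact torusCurve_swap 0 1
    obtain ⟨F⟩ := key ⟨_, hM⟩
    obtain ⟨G⟩ := nonempty_gluedTori_prodComm_homeomorph
    exact ⟨F.trans G⟩
  -- Here `d = ±1`, so the identity is an admissible gluing map; the result is the double of the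
  -- solid torus.
  · rintro rfl
    have hM : Homeomorph.refl Torus '' {t | t.1 = 1} = torusCurve 0 d := by
      have h : torusCurve 0 d = torusCurve 0 1 := by
        rcases Int.isUnit_iff.1 (isCoprime_zero_left.1 hcd) with rfl | rfl
        · rfl
        · exact torusCurve_neg 0 1
      rw [h, torusCurve_zero_one]
      exact Set.image_id _
    obtain ⟨F⟩ := key ⟨_, hM⟩
    obtain ⟨G⟩ := nonempty_gluedTori_refl_homeomorph
    exact ⟨F.trans G⟩
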